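/- Let $\mathbb F_d$ be a finite field with $d$ elements, let $S,K,T$ be integers, write $[n]=\{1,\dots,n\}$ and $\mathcal S=\{0,1,\dots,S\}$, and let $\mathcal W:[K]\to 2^{[S]}$ (replication map) and $\mathcal E:[T]\to 2^{[S]}$ (erasure map) be arbitrary. A quantum coding scheme of batch size $L\ge 1$ consists of: dimensions $\delta_s\ge 1$ $(s\in\mathcal S)$; a density operator $\rho^{\mathrm{init}}$ on $\mathcal Q_0\otimes\mathcal Q_1\otimes\cdots\otimes\mathcal Q_S$ (finite-dimensional, $\dim\mathcal Q_0=\delta_0$), independent of the data; for each data-server $s\in[S]$ and each value of its local data $x_s=(w_k: s\in\mathcal W(k))$ with $w_k\in\mathbb F_d^L$, a quantum channel (completely positive trace-preserving map) $\Phi_s^{(x_s)}$ from operators on $\mathcal Q_s$ to operators on a space of dimension $\delta_s$; and for each $t\in[T]$ a measurement (POVM) of the output systems of the servers in $\mathcal S\setminus\mathcal E(t)$, with outcomes in $\mathbb F_d^L$. Server $0$ holds no data, applies the identity and is never erased. It is required that for all $w=(w_1,\dots,w_K)\in(\mathbb F_d^{L})^K$ and all $t\in[T]$, measuring the reduced state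 of $(\mathbf I\otimes\Phi_1^{(x_1)}\otimes\cdots\otimes\Phi_S^{(x_S)})(\rho^{\mathrm{init}})$ on the servers in $\mathcal S\setminus\mathcal E(t)$ yields $w_1+\cdots+w_K$ with probability $1$. The cost tuple of the scheme is $(\Delta_s)_{s\in\mathcal S}$ with $\Delta_s=\log_d(\delta_s)/L$. Let $\mathfrak D^*\subseteq\mathbb R^{S+1}$ be the closure of the cost tuples achieved as $L\to\infty$, i.e. $\mathfrak D^*=\bigcap_{L_0}\overline{\bigcup_{L>L_0}\{\text{cost tuples of schemes of batch size }L\}}$. Then $$\mathrm{conv}\big(\mathfrak D_{\mathrm{AME}}^+\cup\mathfrak D_{\mathrm{TQC}}^+\big)\subseteq\mathfrak D^*,$$ where $$\mathfrak D_{\mathrm{AME}}=\Big\{\Delta\in\mathbb R_{\ge0}^{S+1}:\ \min\Big\{\sum_{s\in\mathcal S}\Delta_s,\ \sum_{s\in\mathcal W(k)}2\Delta_s\Big\}-\sum_{s\in\mathcal E(t)}2\Delta_s\ge1\ \ \forall k\in[K],\,t\in[T]\Big\},$$ $$\mathfrak D_{\mathrm{TQC}}=\Big\{\Delta\in\mathbb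 R_{\ge0}^{S+1}:\ \sum_{s\in\mathcal W(k)}\Delta_s-\sum_{s\in\mathcal E(t)}\Delta_s\ge1\ \ \forall k\in[K],\,t\in[T]\Big\},$$ and, for $x\in\{\mathrm{AME},\mathrm{TQC}\}$, $$\mathfrak D_x^+=\{\Delta^+\in\mathbb R_{\ge0}^{S+1}:\ \exists\,\Delta\in\mathfrak D_x,\ \Delta^+_s\ge\Delta_s\ \forall s\in\mathcal S\}.$$ -/

import Mathlib

open scoped ComplexOrder Matrix

noncomputable section

namespace QEMAC

/-! ### Finite-dimensional quantum systems, channels and measurements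

A system of dimension `n` has Hilbert space `ℂ ^ n` with its standard basis; operators are complex
matrices.  A composite system is indexed by the product of the index sets of its parts. -/

/-- Density operators: positive semidefinite with trace one. -/
def IsDensity {m : Type*} [Fintype m] (ρ : Matrix m m ℂ) : Prop :=
  ρ.PosSemidef ∧ ρ.trace = 1

/-- The map `id_r ⊗ Φ` on operators on `ℂ ^ r ⊗ ℂ ^ m`: `Φ` applied to each of the `r * r` blocks. -/
def ampliate {m n : Type*} (Φ : Matrix m m ℂ →ₗ[ℂ] Matrix n n ℂ) (r : ℕ)
    (X : Matrix (Fin r × m) (Fin r × m) ℂ) : Matrix (Fin r × n) (Fin r × n) ℂ :=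
  Matrix.of fun p q => Φ (Matrix.of fun a b => X (p.1, a) (q.1, b)) p.2 q.2

/-- Quantum channels: completely positive trace-preserving linear maps. -/
structure IsChannel {m n : Type*} [Fintype m] [Fintype n]
    (Φ : Matrix m m ℂ →ₗ[ℂ] Matrix n n ℂ) : Prop where
  completelyPositive : ∀ (r : ℕ) (X : Matrix (Fin r × m) (Fin r × m) ℂ),
    X.PosSemidef → (ampliate Φ r X).PosSemidef
  tracePreserving : ∀ X : Matrix m m ℂ, (Φ X).trace = X.trace

/-- A positive operator valued measure with outcomes in `Y`. -/
structure IsPOVM {m Y : Type*} [Fintype m] [DecidableEq m] [Fintype Y]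
    (Λ : Y → Matrix m m ℂ) : Prop where
  posSemidef : ∀ y, (Λ y).PosSemidef
  sum_eq_one : ∑ y, Λ y = 1

/-- The probability that the measurement `Λ` of the state `ρ` outputs `y`, namely `Tr (Λ_y ρ)`. -/
def outcomeProb {m Y : Type*} [Fintype m] (Λ : Y → Matrix m m ℂ) (ρ : Matrix m m ℂ) (y : Y) : ℂ :=
  (Λ y * ρ).trace

/-- Basis labels of the composite system `Q₀ ⊗ (⨂ s, Q_s)`, where `Q₀` has dimension `n₀` and
`Q_s` has dimension `n s`. -/
abbrev JointIndex {ι : Type*} (n₀ : ℕ) (n : ι → ℕ) : Type _ :=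
  Fin n₀ × (∀ s, Fin (n s))

/-- The map `I ⊗ (⨂ s, Φ s)`.  On the matrix unit `|a⟩⟨a'| ⊗ (⨂ s, |i s⟩⟨i' s|)` it takes the value
`|a⟩⟨a'| ⊗ (⨂ s, Φ s |i s⟩⟨i' s|)`; it is extended linearly. -/
def applyLocal {ι : Type*} [Fintype ι] [DecidableEq ι] {n₀ : ℕ} {m n : ι → ℕ}
    (Φ : ∀ s, Matrix (Fin (m s)) (Fin (m s)) ℂ →ₗ[ℂ] Matrix (Fin (n s)) (Fin (n s)) ℂ)
    (ρ : Matrix (JointIndex n₀ m) (JointIndex n₀ m) ℂ) :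
    Matrix (JointIndex n₀ n) (JointIndex n₀ n) ℂ :=
  Matrix.of fun p q =>
    ∑ i : (∀ s, Fin (m s)), ∑ i' : (∀ s, Fin (m s)),
      ρ (p.1, i) (q.1, i') * ∏ s, Φ s (Matrix.single (i s) (i' s) 1) (p.2 s) (q.2 s)

/-- Assemble the labels of the subsystems outside `A` and those of the subsystems in `A`. -/
def glue {ι : Type*} [DecidableEq ι] {n : ι → ℕ} (A : Finset ι)
    (j : ∀ s : {s // s ∉ A}, Fin (n s.1)) (e : ∀ s : {s // s ∈ A}, Fin (n s.1)) :
    ∀ s, Fin (n s) :=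
  fun s => if h : s ∈ A then e ⟨s, h⟩ else j ⟨s, h⟩

/-- The reduced state after tracing out the subsystems `Q_s` with `s ∈ A`. -/
def traceOut {ι : Type*} [Fintype ι] [DecidableEq ι] {n₀ : ℕ} {n : ι → ℕ} (A : Finset ι)
    (ρ : Matrix (JointIndex n₀ n) (JointIndex n₀ n) ℂ) :
    Matrix (JointIndex n₀ fun s : {s // s ∉ A} => n s.1)
      (JointIndex n₀ fun s : {s // s ∉ A} => n s.1) ℂ :=
  Matrix.of fun p q =>
    ∑ e : (∀ s : {s // s ∈ A}, Fin (n s.1)), ρ (p.1, glue A p.2 e) (q.1, glue A q.2 e)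

/-! ### Coding schemes

The data-servers are indexed by `Fin S`.  In families over all servers, indexed by `Fin (S + 1)`,
the index `0` is the auxiliary server and `s.succ` is the data-server `s : Fin S`. -/

/-- The data available to the data-server `s`: the batches `w k` of the streams `k` with
`s ∈ W k`. -/
abbrev LocalData (F : Type*) {S K : ℕ} (W : Fin K → Finset (Fin S)) (L : ℕ) (s : Fin S) : Type _ :=
  ∀ _k : {k : Fin K // s ∈ W k}, Fin L → F

/-- The part of the data realization `w` that is available to the data-server `s`. -/
def localData {F : Type*} {S K : ℕ} (W : Fin K → Finset (Fin S)) {L : ℕ}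
    (w : Fin K → Fin L → F) (s : Fin S) : LocalData F W L s :=
  fun k => w k.1

/-- A quantum coding scheme with batch size `L` for data streams over `F`, replication map `W` and
erasure map `E`. -/
structure Scheme (F : Type*) [Fintype F] {S K T : ℕ}
    (W : Fin K → Finset (Fin S)) (E : Fin T → Finset (Fin S)) (L : ℕ) where
  /-- The dimension of the subsystem that each server transmits. -/
  dim : Fin (S + 1) → ℕ
  dim_pos : ∀ s, 0 < dim s
  /-- The dimension of the subsystem that each data-server holds before encoding.  The auxiliary
  server does not encode, so its subsystem has dimension `dim 0` throughout. -/
  initDim : Fin S → ℕ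
  /-- The shared initial state, which does not depend on the data. -/
  init : Matrix (JointIndex (dim 0) initDim) (JointIndex (dim 0) initDim) ℂ
  init_density : IsDensity init
  /-- The encoding operations. -/
  enc : ∀ s : Fin S, LocalData F W L s →
    (Matrix (Fin (initDim s)) (Fin (initDim s)) ℂ →ₗ[ℂ]
      Matrix (Fin (dim s.succ)) (Fin (dim s.succ)) ℂ)
  enc_channel : ∀ s x, IsChannel (enc s x)
  /-- The measurement used by the receiver for each erasure pattern. -/
  dec : ∀ t : Fin T, (Fin L → F) →
    Matrix (JointIndex (dim 0) fun s : {s // s ∉ E t} => dim s.1.succ)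
      (JointIndex (dim 0) fun s : {s // s ∉ E t} => dim s.1.succ) ℂ
  dec_povm : ∀ t, IsPOVM (dec t)

namespace Scheme

variable {F : Type*} [Fintype F] {S K T : ℕ}
  {W : Fin K → Finset (Fin S)} {E : Fin T → Finset (Fin S)} {L : ℕ}

/-- The joint state after encoding the data realization `w`. -/
def encoded (C : Scheme F W E L) (w : Fin K → Fin L → F) :
    Matrix (JointIndex (C.dim 0) fun s : Fin S => C.dim s.succ)
      (JointIndex (C.dim 0) fun s : Fin S => C.dim s.succ) ℂ :=
  applyLocal (fun s => C.enc s (localData W w s)) C.init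

/-- The state at the receiver when the answers of the servers in `E t` are erased. -/
def received (C : Scheme F W E L) (w : Fin K → Fin L → F) (t : Fin T) :
    Matrix (JointIndex (C.dim 0) fun s : {s // s ∉ E t} => C.dim s.1.succ)
      (JointIndex (C.dim 0) fun s : {s // s ∉ E t} => C.dim s.1.succ) ℂ :=
  traceOut (E t) (C.encoded w)

/-- For every data realization and every erasure pattern, the receiver obtains the sum of the data
streams with probability one. -/
def Correct [Field F] (C : Scheme F W E L) : Prop :=
  ∀ (w : Fin K → Fin L → F) (t : Fin T),
    outcomeProb (C.dec t) (C.received w t) (∑ k, w k) = 1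

/-- The normalized download costs `log_d (dim s) / L`, where `d` is the size of the field. -/
def cost (C : Scheme F W E L) : Fin (S + 1) → ℝ :=
  fun s => Real.logb (Fintype.card F) (C.dim s) / L

end Scheme

/-- The cost tuples of the correct schemes with batch size `L`. -/
def achieved (F : Type*) [Field F] [Fintype F] {S K T : ℕ}
    (W : Fin K → Finset (Fin S)) (E : Fin T → Finset (Fin S)) (L : ℕ) : Set (Fin (S + 1) → ℝ) :=
  {Δ | ∃ C : Scheme F W E L, C.Correct ∧ C.cost = Δ}

/-- The optimal cost region: the tuples that are approximated arbitrarily well by cost tuples of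
correct schemes with arbitrarily large batch sizes. -/
def optimalRegion (F : Type*) [Field F] [Fintype F] {S K T : ℕ}
    (W : Fin K → Finset (Fin S)) (E : Fin T → Finset (Fin S)) : Set (Fin (S + 1) → ℝ) :=
  ⋂ L₀ : ℕ, closure (⋃ L > L₀, achieved F W E L)

/-! ### The inner bound -/

/-- The region obtained from absolutely maximally entangled states. -/
def regionAME {S K T : ℕ} (W : Fin K → Finset (Fin S)) (E : Fin T → Finset (Fin S)) :
    Set (Fin (S + 1) → ℝ) :=
  {Δ | (∀ s, 0 ≤ Δ s) ∧ ∀ (k : Fin K) (t : Fin T),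
    1 ≤ min (∑ s, Δ s) (∑ s ∈ W k, 2 * Δ s.succ) - ∑ s ∈ E t, 2 * Δ s.succ}

/-- The region obtained by treating qudits as classical dits. -/
def regionTQC {S K T : ℕ} (W : Fin K → Finset (Fin S)) (E : Fin T → Finset (Fin S)) :
    Set (Fin (S + 1) → ℝ) :=
  {Δ | (∀ s, 0 ≤ Δ s) ∧ ∀ (k : Fin K) (t : Fin T),
    1 ≤ ∑ s ∈ W k, Δ s.succ - ∑ s ∈ E t, Δ s.succ}

/-- The upward closure of a set of cost tuples, within the non-negative orthant. -/
def upward {S : ℕ} (D : Set (Fin (S + 1) → ℝ)) : Set (Fin (S + 1) → ℝ) :=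
  {Δ' | (∀ s, 0 ≤ Δ' s) ∧ ∃ Δ ∈ D, ∀ s, Δ s ≤ Δ' s}

/-- The convex hull of the upward closures of the two regions. -/
def achievableRegion {S K T : ℕ} (W : Fin K → Finset (Fin S)) (E : Fin T → Finset (Fin S)) :
    Set (Fin (S + 1) → ℝ) :=
  convexHull ℝ (upward (regionAME W E) ∪ upward (regionTQC W E))

end QEMAC

end

/-!
The schemes are of Calderbank-Shor-Steane type. Each server holds some qudits over a finite field
`G`, with basis states labelled by words over `G`. The batches are encoded by two classical linear
codes for the sum of the streams (`SumCode`): the codeword of the first one translates the basis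
states, and that of the second one multiplies them by phases. If the checks of the two codes are
orthogonal, then the two kinds of checks can be measured simultaneously, and a state with trivial
syndromes can be shared in advance (`cssState`). A check that avoids the erased servers can be
measured after they are traced out, and its syndrome is a coordinate of the sum
(`cssScheme_correct`). The shared state and the measurements have the explicit form `cssMatrix`,
and the encoded states differ from the former by a conjugation with monomial matrices, so no
general stabilizer theory is needed.

The classical codes are generalized Reed-Solomon codes (`reedSolomon`). If the erased servers hold
at most `n` symbols and every stream is replicated on at least `n + L` symbols, such a code
computes sums of batches of length `L`: the words of polynomials of degree less than `n + L` that
vanish at the erased nodes are the checks, and the data sit at `L` additional evaluation points.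
Using one such code treats the qudits as classical dits and gives `regionTQC`. If moreover
`2 * (n + L)` is at most the total number of symbols, a second code twisted by the nodal weights of
Lagrange interpolation is orthogonal to the first one (`reedSolomon_orthogonal`), and the pair
gives `regionAME`.

Direct sums of codes give time sharing, hence convexity. Finally, the codes exist over all large
fields, and an extension `G` of `F` of degree `z` is additively `F ^ z`, so that a code over `G`
is a scheme for `F` with arbitrarily large batches and the same cost tuple
(`HasCSSCodes.exists_mem_achieved`).
-/

noncomputable section

namespace QEMAC

/-! ### Matrices of CSS type over finite abelian groups -/

section CSSMatrix
variable {B U Z : Type*} [AddCommGroup B] [Fintype B] [DecidableEq B] [AddCommGroup U] [Fintype U]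
  [AddCommGroup Z] [DecidableEq Z]

/-- The matrix `∑ c, φ c • P_z X^{δ c}` on `ℂ[B]`, where `P_z` is the projection onto the basis
vectors `p` with `ζ p = z` and `X^b` is the translation by `b`.  If `ζ ∘ δ = 0`, then it is `|U|` times
an orthogonal projection: the joint eigenprojection of a measurement of `ζ` and of the translations
along `δ`. -/
def cssMatrix (ζ : B →+ Z) (δ : U →+ B) (z : Z) (φ : AddChar U ℂ) : Matrix B B ℂ :=
  Matrix.of fun p q => if ζ p = z then ∑ c, if p - q = δ c then φ c else 0 else 0

/-- Up to the factor `|U|`, a matrix of CSS type with `ζ ∘ δ = 0` is a projection. -/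
theorem cssMatrix_mul_conjTranspose (ζ : B →+ Z) (δ : U →+ B) (hζδ : ∀ c, ζ (δ c) = 0) (z : Z)
    (φ : AddChar U ℂ) :
    cssMatrix ζ δ z φ * (cssMatrix ζ δ z φ)ᴴ = (Fintype.card U : ℂ) • cssMatrix ζ δ z φ := by
  ext p q
  simp only [Matrix.mul_apply, Matrix.conjTranspose_apply, cssMatrix, Matrix.of_apply,
    Matrix.smul_apply, smul_eq_mul]
  by_cases hp : ζ p = z
  · simp only [hp, if_true]
    by_cases hq : ζ q = z
    · simp only [hq, if_true, star_sum, apply_ite star, star_zero, Finset.sum_mul_sum, ite_mul,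
        mul_ite, mul_zero, zero_mul]
      rw [Finset.sum_comm]
      have h1 : ∀ c : U, (∑ r, ∑ c', if q - r = δ c' then (if p - r = δ c then φ c * star (φ c')
          else 0) else 0) = ∑ c', if p - q = δ c' then φ c' else 0 := by
        intro c
        rw [Finset.sum_comm]
        -- The pairs `(c, c')` are regrouped by their difference, which is what the entry at
        -- `p - q` depends on.
        rw [← Equiv.sum_comp (Equiv.subLeft c)]
        refine Finset.sum_congr rfl fun c' _ => ?_
        have h2 : ∀ r, q - r = δ (c - c') ↔ r = q - δ (c - c') := fun r => by
          rw [sub_eq_iff_eq_add, eq_sub_iff_add_eq, add_comm r, eq_comm]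
        simp only [Equiv.subLeft_apply, h2, Finset.sum_ite_eq', Finset.mem_univ, if_true]
        have h3 : p - (q - δ (c - c')) = δ c ↔ p - q = δ c' := by
          rw [map_sub]
          constructor
          · intro h
            rw [← sub_eq_zero] at h ⊢
            rw [← h]; abel
          · intro h
            rw [← sub_eq_zero] at h ⊢
            rw [← h]; abel
        simp only [h3]
        congr 1
        rw [← starRingEnd_apply, ← AddChar.map_neg_eq_conj, ← AddChar.map_add_eq_mul]
        congr 1; abel
      simp only [h1, Finset.sum_const, Finset.card_univ, nsmul_eq_mul]
    · have h2 : ∀ c, p - q ≠ δ c := by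
        intro c hc
        apply hq
        rw [← hp, ← sub_eq_zero, ← map_sub, ← neg_sub, map_neg, hc, hζδ, neg_zero]
      simp [hq, h2]
  · simp [hp]

theorem cssMatrix_posSemidef (ζ : B →+ Z) (δ : U →+ B) (hζδ : ∀ c, ζ (δ c) = 0) (z : Z)
    (φ : AddChar U ℂ) : (cssMatrix ζ δ z φ).PosSemidef := by
  have h := cssMatrix_mul_conjTranspose ζ δ hζδ z φ
  have hU : (Fintype.card U : ℂ) ≠ 0 := by exact_mod_cast Fintype.card_ne_zero
  have h2 : cssMatrix ζ δ z φ =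
      (Fintype.card U : ℂ)⁻¹ • (cssMatrix ζ δ z φ * (cssMatrix ζ δ z φ)ᴴ) := by
    rw [h, smul_smul, inv_mul_cancel₀ hU, one_smul]
  rw [h2]
  refine (Matrix.posSemidef_self_mul_conjTranspose _).smul ?_
  exact inv_nonneg.mpr (by exact_mod_cast Nat.zero_le _)

omit [Fintype B] in
/-- If `φ` runs through all characters of `U` (which the hypothesis expresses as an orthogonality
relation), then the normalized matrices of CSS type resolve the identity. -/
theorem sum_cssMatrix {Y : Type*} [Fintype Y] [Fintype Z] [DecidableEq U] (ζ : B →+ Z) (δ : U →+ B)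
    (φ : Y → AddChar U ℂ)
    (hφ : ∀ c, ∑ y, φ y c = if c = 0 then (Fintype.card U : ℂ) else 0) :
    ∑ x : Z × Y, cssMatrix ζ δ x.1 (φ x.2) = (Fintype.card U : ℂ) • 1 := by
  ext p q
  simp only [Matrix.sum_apply, cssMatrix, Matrix.of_apply, Matrix.smul_apply, smul_eq_mul,
    Fintype.sum_prod_type_right, Finset.sum_ite_eq, Finset.mem_univ, if_true]
  rw [Finset.sum_comm]
  have : ∀ c, (∑ y, if p - q = δ c then φ y c else 0) =
      if c = 0 then (if p - q = δ c then (Fintype.card U : ℂ) else 0) else 0 := by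
    intro c
    by_cases h : p - q = δ c
    · simp only [h, if_true, hφ]
    · simp [h]
  simp only [this, Finset.sum_ite_eq', Finset.mem_univ, if_true, map_zero, sub_eq_zero,
    Matrix.one_apply, mul_ite, mul_one, mul_zero]

omit [Fintype B] in
theorem cssMatrix_sub_left (ζ : B →+ Z) (δ : U →+ B) (hζδ : ∀ c, ζ (δ c) = 0) (z : Z) (x : B)
    (c : U) : cssMatrix ζ δ z 1 (x - δ c) x = cssMatrix ζ δ z 1 x x := by
  simp only [cssMatrix, Matrix.of_apply, map_sub, hζδ, sub_zero, AddChar.one_apply]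
  congr 1
  rw [← Equiv.sum_comp (Equiv.subRight c)]
  refine Finset.sum_congr rfl fun c' _ => ?_
  congr 1
  simp only [Equiv.subRight_apply, map_sub, sub_self, eq_iff_iff]
  rw [sub_sub_cancel_left, neg_eq_iff_add_eq_zero, add_sub_cancel, eq_comm]

theorem trace_cssMatrix_ne_zero (ζ : B →+ Z) (δ : U →+ B) :
    (cssMatrix ζ δ 0 1).trace ≠ 0 := by
  have : (cssMatrix ζ δ 0 1).trace =
      ((∑ p, if ζ p = 0 then ∑ c, if δ c = 0 then 1 else 0 else 0 : ℕ) : ℂ) := by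
    simp [Matrix.trace, cssMatrix, eq_comm]
  rw [this, Nat.cast_ne_zero, ← Nat.pos_iff_ne_zero]
  refine Finset.sum_pos' (fun _ _ => Nat.zero_le _) ⟨0, Finset.mem_univ _, ?_⟩
  rw [if_pos (map_zero _)]
  refine Finset.sum_pos' (fun _ _ => Nat.zero_le _) ⟨0, Finset.mem_univ _, ?_⟩
  simp

omit [Fintype B] in
/-- The measurement by matrices of CSS type outputs `(z, φ)` with certainty on a state `σ` whose
diagonal is supported on `ζ = z` and which translation along `δ` multiplies by the conjugate of
`φ`.  The index set of `σ` is identified with the group `B` by `e`. -/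
theorem trace_cssMatrix_mul_eq_one {P : Type*} [Fintype P] [DecidableEq P] (e : P ≃ B) (ζ : B →+ Z)
    (δ : U →+ B) (z : Z) (φ : AddChar U ℂ) (σ : Matrix P P ℂ)
    (hshift : ∀ p c, φ c * σ (e.symm (e p - δ c)) p = σ p p)
    (hdiag : ∀ p, σ p p ≠ 0 → ζ (e p) = z) (htr : σ.trace = 1) :
    ((((Fintype.card U : ℂ)⁻¹ • cssMatrix ζ δ z φ).submatrix e e) * σ).trace = 1 := by
  have hU : (Fintype.card U : ℂ) ≠ 0 := by exact_mod_cast Fintype.card_ne_zero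
  rw [← htr]
  simp only [Matrix.trace, Matrix.diag_apply, Matrix.mul_apply, Matrix.submatrix_apply,
    Matrix.smul_apply, cssMatrix, Matrix.of_apply, smul_eq_mul]
  refine Finset.sum_congr rfl fun p _ => ?_
  by_cases hp : ζ (e p) = z
  · simp only [hp, if_true, Finset.mul_sum, Finset.sum_mul]
    rw [Finset.sum_comm]
    have : ∀ c, (∑ q, (Fintype.card U : ℂ)⁻¹ * (if e p - e q = δ c then φ c else 0) * σ q p)
        = (Fintype.card U : ℂ)⁻¹ * σ p p := by
      intro c
      rw [Finset.sum_eq_single (e.symm (e p - δ c))]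
      · simp [← hshift p c, mul_assoc]
      · intro q _ hq
        rw [if_neg]
        · simp
        · intro h
          apply hq
          rw [← h]; simp
      · simp
    simp only [this, Finset.sum_const, Finset.card_univ, nsmul_eq_mul]
    rw [mul_inv_cancel_left₀ hU]
  · have : σ p p = 0 := by
      by_contra h
      exact hp (hdiag p h)
    simp [hp, this]

end CSSMatrix

/-! ### Monomial channels -/

section Monomial

/-- The map `X ↦ V X Vᴴ` for the monomial matrix `V` that takes the basis vector `τ p` to `c p`
times the basis vector `p`. -/
def monomialMap {m : Type*} (c : m → ℂ) (τ : m ≃ m) : Matrix m m ℂ →ₗ[ℂ] Matrix m m ℂ where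
  toFun X := Matrix.of fun p q => c p * star (c q) * X (τ p) (τ q)
  map_add' X Y := by ext; simp [mul_add]
  map_smul' a X := by ext; simp; ring

theorem isChannel_monomialMap {m : Type*} [Fintype m] {c : m → ℂ} (hc : ∀ p, c p * star (c p) = 1)
    (τ : m ≃ m) : IsChannel (monomialMap c τ) where
  completelyPositive r X hX := by
    classical
    have : ampliate (monomialMap c τ) r X =
        Matrix.diagonal (fun p : Fin r × m => c p.2) *
          X.submatrix (fun p => (p.1, τ p.2)) (fun p => (p.1, τ p.2)) *
          (Matrix.diagonal (fun p : Fin r × m => c p.2))ᴴ := by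
      ext p q
      simp [ampliate, monomialMap, Matrix.diagonal_conjTranspose]
      ring
    rw [this]
    exact (hX.submatrix _).mul_mul_conjTranspose_same _
  tracePreserving X := by
    simp only [Matrix.trace, Matrix.diag_apply, monomialMap, LinearMap.coe_mk, AddHom.coe_mk,
      Matrix.of_apply, hc, one_mul]
    exact Equiv.sum_comp τ fun p => X p p

theorem applyLocal_monomialMap {ι : Type*} [Fintype ι] [DecidableEq ι] {n₀ : ℕ} {n : ι → ℕ}
    (c : ∀ s, Fin (n s) → ℂ) (τ : ∀ s, Fin (n s) ≃ Fin (n s))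
    (ρ : Matrix (JointIndex n₀ n) (JointIndex n₀ n) ℂ) (p q : JointIndex n₀ n) :
    applyLocal (fun s => monomialMap (c s) (τ s)) ρ p q =
      (∏ s, c s (p.2 s) * star (c s (q.2 s))) *
        ρ (p.1, fun s => τ s (p.2 s)) (q.1, fun s => τ s (q.2 s)) := by
  simp only [applyLocal, Matrix.of_apply, monomialMap, LinearMap.coe_mk, AddHom.coe_mk]
  rw [Finset.sum_eq_single (fun s => τ s (p.2 s)), Finset.sum_eq_single (fun s => τ s (q.2 s))]
  · simp [mul_comm]
  · intro i' _ hi'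
    obtain ⟨s, hs⟩ := Function.ne_iff.mp hi'
    rw [Finset.prod_eq_zero (Finset.mem_univ s), mul_zero]
    simp [hs]
  · simp
  · intro i _ hi
    obtain ⟨s, hs⟩ := Function.ne_iff.mp hi
    refine Finset.sum_eq_zero fun i' _ => ?_
    rw [Finset.prod_eq_zero (Finset.mem_univ s), mul_zero]
    simp [hs]
  · simp

end Monomial

/-! ### Sum codes and the symbols held by the servers -/

/-- A classical code with linear decoding for the sum of the streams, over the field `G`, with symbols indexed by
`I`, where the symbol `i` is sent by the server `srv i`.  The stream `k` adds the word `enc k w`,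
which is supported on the servers holding it; the receiver recovers the coordinate `l` of the sum
as the inner product of the received word with `check t l`, which avoids the erased servers.
Server `0` holds no data, so all codewords vanish on it. -/
structure SumCode (G : Type*) [Field G] {S K T : ℕ} {I : Type*} [Fintype I]
    (W : Fin K → Finset (Fin S)) (E : Fin T → Finset (Fin S)) (srv : I → Fin (S + 1))
    (Y : Type*) where
  enc : Fin K → (Y → G) → I → G
  enc_eq_zero : ∀ k w i, (∀ s ∈ W k, srv i ≠ s.succ) → enc k w i = 0
  check : Fin T → Y → I → G
  check_eq_zero : ∀ t l i, ∀ s ∈ E t, srv i = s.succ → check t l i = 0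
  check_dotProduct_enc : ∀ t l k w, check t l ⬝ᵥ enc k w = w l

section Coordinates

variable {G : Type*} [Field G] [Fintype G] [DecidableEq G] {S : ℕ} {I : Type*} [Fintype I]
  [DecidableEq I] (srv : I → Fin (S + 1))

/-- The tuples of symbols of the server `s`. -/
abbrev LocalSymbols (G : Type*) {S : ℕ} {I : Type*} (srv : I → Fin (S + 1)) (s : Fin (S + 1)) :
    Type _ :=
  {i : I // srv i = s} → G

/-- The tuples of symbols of the servers outside `A`, laid out as in `JointIndex`. -/
abbrev JointSymbols (G : Type*) {S : ℕ} {I : Type*} (srv : I → Fin (S + 1))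
    (A : Finset (Fin S)) : Type _ :=
  LocalSymbols G srv 0 × (∀ s : {s : Fin S // s ∉ A}, LocalSymbols G srv s.1.succ)

/-- The tuples of symbols of all servers, laid out as in `JointIndex`. -/
abbrev AllSymbols (G : Type*) {S : ℕ} {I : Type*} (srv : I → Fin (S + 1)) : Type _ :=
  LocalSymbols G srv 0 × (∀ s : Fin S, LocalSymbols G srv s.succ)

variable (G) in
/-- The dimension of the system of the server `s`, whose basis is labelled by its symbols. -/
abbrev symbolDim (s : Fin (S + 1)) : ℕ := Fintype.card (LocalSymbols G srv s)

variable (G) in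
/-- A numbering of the tuples of symbols of the server `s`. -/
def symbolEquiv (s : Fin (S + 1)) : Fin (symbolDim G srv s) ≃ LocalSymbols G srv s :=
  (Fintype.equivFin _).symm

variable (G) in
def allEquiv : JointIndex (symbolDim G srv 0) (fun s : Fin S => symbolDim G srv s.succ) ≃
    AllSymbols G srv :=
  Equiv.prodCongr (symbolEquiv G srv 0) (Equiv.piCongrRight fun s => symbolEquiv G srv s.succ)

variable (G) in
def jointEquiv (A : Finset (Fin S)) :
    JointIndex (symbolDim G srv 0) (fun s : {s : Fin S // s ∉ A} => symbolDim G srv s.1.succ) ≃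
    JointSymbols G srv A :=
  Equiv.prodCongr (symbolEquiv G srv 0) (Equiv.piCongrRight fun s => symbolEquiv G srv s.1.succ)

/-- A word over `I`, split into the parts of the servers. -/
def restrictAll : (I → G) →+ AllSymbols G srv where
  toFun x := (fun i => x i, fun _ i => x i)
  map_zero' := rfl
  map_add' _ _ := rfl

/-- The part of a word over `I` that belongs to the servers outside `A`. -/
def restrictJoint (A : Finset (Fin S)) : (I → G) →+ JointSymbols G srv A where
  toFun x := (fun i => x i, fun _ i => x i)
  map_zero' := rfl
  map_add' _ _ := rfl

/-- The inner product with the word `c`. -/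
def pairAll (c : I → G) : AllSymbols G srv →+ G where
  toFun p := ∑ i, c i.1 * p.1 i + ∑ s, ∑ i, c i.1 * p.2 s i
  map_zero' := by simp
  map_add' p q := by
    simp only [Prod.fst_add, Prod.snd_add, Pi.add_apply, mul_add, Finset.sum_add_distrib]
    ring

/-- The inner product with the part of the word `c` on the servers outside `A`. -/
def pairJoint (A : Finset (Fin S)) (c : I → G) : JointSymbols G srv A →+ G where
  toFun p := ∑ i, c i.1 * p.1 i + ∑ s, ∑ i, c i.1 * p.2 s i
  map_zero' := by simp
  map_add' p q := by
    simp only [Prod.fst_add, Prod.snd_add, Pi.add_apply, mul_add, Finset.sum_add_distrib]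
    ring

omit [Fintype G] [DecidableEq G] [DecidableEq I] in
theorem pairAll_restrictAll (c x : I → G) : pairAll srv c (restrictAll srv x) = c ⬝ᵥ x := by
  have h := Fintype.sum_fiberwise srv (fun i => c i * x i)
  rw [Fin.sum_univ_succ] at h
  exact h

omit [Fintype G] [DecidableEq G] [DecidableEq I] in
theorem pairJoint_eq_pairAll (A : Finset (Fin S)) (c : I → G)
    (hc : ∀ i, ∀ s ∈ A, srv i = s.succ → c i = 0) (p : AllSymbols G srv) :
    pairJoint srv A c (p.1, fun s => p.2 s.1) = pairAll srv c p := by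
  simp only [pairJoint, pairAll, AddMonoidHom.coe_mk, ZeroHom.coe_mk]
  congr 1
  rw [← Fintype.sum_subtype_add_sum_subtype (fun s => s ∉ A), left_eq_add]
  refine Finset.sum_eq_zero fun s _ => Finset.sum_eq_zero fun i _ => ?_
  rw [hc i.1 s.1 (not_not.mp s.2) i.2, zero_mul]

omit [Field G] [DecidableEq G] in
/-- The symbols of the servers outside `A` do not depend on the labels `e` of those in `A`. -/
theorem jointEquiv_eq (A : Finset (Fin S))
    (p : JointIndex (symbolDim G srv 0)
      (fun s : {s : Fin S // s ∉ A} => symbolDim G srv s.1.succ))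
    (e : ∀ s : {s // s ∈ A}, Fin (symbolDim G srv s.1.succ)) :
    jointEquiv G srv A p = ((allEquiv G srv (p.1, glue A p.2 e)).1,
      fun s : {s : Fin S // s ∉ A} => (allEquiv G srv (p.1, glue A p.2 e)).2 s.1) := by
  ext s
  · rfl
  · simp [jointEquiv, allEquiv, glue, s.2]

omit [DecidableEq G] in
/-- Translating the surviving systems by a word that vanishes on the servers in `A` is the same as
translating all systems. -/
theorem allEquiv_glue_sub (A : Finset (Fin S)) (x : I → G)
    (hx : ∀ i, ∀ s ∈ A, srv i = s.succ → x i = 0)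
    (p : JointIndex (symbolDim G srv 0)
      (fun s : {s : Fin S // s ∉ A} => symbolDim G srv s.1.succ))
    (e : ∀ s : {s // s ∈ A}, Fin (symbolDim G srv s.1.succ)) :
    allEquiv G srv (((jointEquiv G srv A).symm (jointEquiv G srv A p - restrictJoint srv A x)).1,
      glue A ((jointEquiv G srv A).symm (jointEquiv G srv A p - restrictJoint srv A x)).2 e) =
    allEquiv G srv (p.1, glue A p.2 e) - restrictAll srv x := by
  set q := (jointEquiv G srv A).symm (jointEquiv G srv A p - restrictJoint srv A x) with hq
  have h : jointEquiv G srv A q = jointEquiv G srv A p - restrictJoint srv A x := by simp [hq]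
  rw [jointEquiv_eq srv A q e, jointEquiv_eq srv A p e] at h
  have h₁ := congrArg Prod.fst h
  have h₂ := congrArg Prod.snd h
  refine Prod.ext h₁ (funext fun s => ?_)
  by_cases hs : s ∈ A
  · have h0 : (restrictAll srv x).2 s = 0 := by
      ext i
      exact hx i.1 s hs i.2
    rw [Prod.snd_sub, Pi.sub_apply, h0, sub_zero]
    simp [allEquiv, glue, hs]
  · exact congrFun h₂ ⟨s, hs⟩

theorem trace_traceOut {ι : Type*} [Fintype ι] [DecidableEq ι] {n₀ : ℕ} {n : ι → ℕ} (A : Finset ι)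
    (ρ : Matrix (JointIndex n₀ n) (JointIndex n₀ n) ℂ) : (traceOut A ρ).trace = ρ.trace := by
  simp only [Matrix.trace, Matrix.diag_apply, traceOut, Matrix.of_apply, Fintype.sum_prod_type]
  refine Finset.sum_congr rfl fun a _ => ?_
  rw [← (Equiv.piEquivPiSubtypeProd (fun s => s ∈ A) (fun s => Fin (n s))).symm.sum_comp,
    Fintype.sum_prod_type_right]
  rfl

end Coordinates

/-! ### Characters of a coordinate space over a finite field -/

section DotChar
variable {G : Type*} [Field G] [Fintype G] [DecidableEq G] {Y : Type*} [Fintype Y] [DecidableEq Y]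

/-- The character `c ↦ χ (c ⬝ᵥ y)`. -/
def dotChar (χ : AddChar G ℂ) (y : Y → G) : AddChar (Y → G) ℂ :=
  χ.compAddMonoidHom (AddMonoidHom.mk' (fun c => c ⬝ᵥ y) fun _ _ => add_dotProduct _ _ _)

omit [Fintype G] [DecidableEq G] [DecidableEq Y] in
theorem dotChar_apply (χ : AddChar G ℂ) (y c : Y → G) : dotChar χ y c = χ (c ⬝ᵥ y) := rfl

theorem sum_dotChar {χ : AddChar G ℂ} (hχ : χ ≠ 1) (c : Y → G) :
    ∑ y, dotChar χ y c = if c = 0 then (Fintype.card (Y → G) : ℂ) else 0 := by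
  classical
  have h : ∀ y, dotChar χ y c = dotChar χ c y := fun y => by
    rw [dotChar_apply, dotChar_apply, dotProduct_comm]
  simp only [h, AddChar.sum_eq_ite]
  congr 1
  rw [eq_iff_iff]
  constructor
  · intro h0
    by_contra hc
    obtain ⟨l, hl⟩ := Function.ne_iff.mp hc
    apply hχ
    ext g
    have := DFunLike.congr_fun h0 (Pi.single l (g * (c l)⁻¹))
    rw [dotChar_apply, single_dotProduct, inv_mul_cancel_right₀ hl] at this
    simpa using this
  · rintro rfl
    ext y
    simp [dotChar_apply]

end DotChar

/-! ### From a pair of orthogonal sum codes to a quantum coding scheme -/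

section Realization

variable {F : Type*} [Field F] [Fintype F] {G : Type*} [Field G] [Fintype G] [DecidableEq G]
  {S K T L : ℕ} {I : Type*} [Fintype I] [DecidableEq I]
  {W : Fin K → Finset (Fin S)} {E : Fin T → Finset (Fin S)} {srv : I → Fin (S + 1)}
  {Y₁ Y₂ : Type*} [Fintype Y₁] [Fintype Y₂] [DecidableEq Y₂]

/-- The contribution to the codeword that the server `s` computes from its own data, after the
batches have been relabelled by `f`. -/
def SumCode.localEnc {Y : Type*} (c : SumCode G W E srv Y) (f : (Fin L → F) → Y → G) (s : Fin S)
    (x : LocalData F W L s) : LocalSymbols G srv s.succ :=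
  fun i => ∑ k, c.enc k.1 (f (x k)) i

/-- The sum of the codewords of all streams. -/
def SumCode.totalEnc {Y : Type*} (c : SumCode G W E srv Y) (f : (Fin L → F) → Y → G)
    (w : Fin K → Fin L → F) : I → G :=
  ∑ k, c.enc k (f (w k))

omit [Fintype G] [Field F] [Fintype F] [DecidableEq G] [DecidableEq I] in
theorem SumCode.localEnc_localData {Y : Type*} (c : SumCode G W E srv Y)
    (f : (Fin L → F) → Y → G) (w : Fin K → Fin L → F) (s : Fin S) :
    c.localEnc f s (localData W w s) = (restrictAll srv (c.totalEnc f w)).2 s := by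
  ext i
  change (∑ k : {k : Fin K // s ∈ W k}, c.enc k.1 (f (w k.1)) i) = (∑ k, c.enc k (f (w k))) i.1
  rw [Finset.sum_apply, ← Fintype.sum_subtype_add_sum_subtype (fun k => s ∈ W k), left_eq_add]
  refine Finset.sum_eq_zero fun k _ => c.enc_eq_zero _ _ _ fun s' hs' h => k.2 ?_
  rw [i.2, Fin.succ_inj] at h
  exact h ▸ hs'

omit [Fintype G] [Field F] [Fintype F] [DecidableEq G] [DecidableEq I] in
theorem SumCode.totalEnc_server_zero {Y : Type*} (c : SumCode G W E srv Y)
    (f : (Fin L → F) → Y → G) (w : Fin K → Fin L → F) (i : I) (hi : srv i = 0) :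
    c.totalEnc f w i = 0 := by
  rw [SumCode.totalEnc, Finset.sum_apply]
  refine Finset.sum_eq_zero fun k _ => c.enc_eq_zero _ _ _ fun s _ h => ?_
  exact Fin.succ_ne_zero s (h.symm.trans hi)

omit [Fintype G] [Field F] [Fintype F] [DecidableEq G] [DecidableEq I] in
theorem SumCode.check_dotProduct_totalEnc {Y : Type*} (c : SumCode G W E srv Y)
    (f : (Fin L → F) → Y → G) (w : Fin K → Fin L → F) (t : Fin T) (l : Y) :
    c.check t l ⬝ᵥ c.totalEnc f w = (∑ k, f (w k)) l := by
  rw [SumCode.totalEnc, dotProduct_sum, Finset.sum_apply]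
  exact Finset.sum_congr rfl fun k _ => c.check_dotProduct_enc _ _ _ _

/-- The inner products of a word with all checks, for all erasure patterns. -/
def SumCode.syndromeAll {Y : Type*} (c : SumCode G W E srv Y) :
    AllSymbols G srv →+ (Fin T × Y → G) :=
  AddMonoidHom.mk' (fun p r => pairAll srv (c.check r.1 r.2) p) fun p q => by
    ext; simp

/-- The inner products with the checks for the erasure pattern `t`, which only involve the
surviving symbols. -/
def SumCode.syndromeJoint {Y : Type*} (c : SumCode G W E srv Y) (t : Fin T) :
    JointSymbols G srv (E t) →+ (Y → G) :=
  AddMonoidHom.mk' (fun p l => pairJoint srv (E t) (c.check t l) p) fun p q => by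
    ext; simp

/-- The linear combination of all checks, for all erasure patterns, with coefficients `g`. -/
def SumCode.combineAll {Y : Type*} [Fintype Y] (c : SumCode G W E srv Y) :
    (Fin T × Y → G) →+ (I → G) :=
  AddMonoidHom.mk' (fun g => ∑ r, g r • c.check r.1 r.2) fun p q => by
    simp [add_smul, Finset.sum_add_distrib]

/-- The linear combination of the checks for the erasure pattern `t`. -/
def SumCode.combine {Y : Type*} [Fintype Y] (c : SumCode G W E srv Y) (t : Fin T) :
    (Y → G) →+ (I → G) :=
  AddMonoidHom.mk' (fun g => ∑ l, g l • c.check t l) fun p q => by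
    simp [add_smul, Finset.sum_add_distrib]

omit [Fintype G] [DecidableEq G] [DecidableEq I] in
theorem SumCode.combine_eq_zero {Y : Type*} [Fintype Y] (c : SumCode G W E srv Y) (t : Fin T)
    (g : Y → G) (i : I) (s : Fin S) (hs : s ∈ E t) (hi : srv i = s.succ) :
    c.combine t g i = 0 := by
  simp [SumCode.combine, c.check_eq_zero t _ i s hs hi]

omit [Fintype G] [DecidableEq G] [DecidableEq I] in
theorem SumCode.combine_eq_combineAll {Y : Type*} [Fintype Y] (c : SumCode G W E srv Y)
    (t : Fin T) (g : Y → G) :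
    c.combine t g = c.combineAll (fun r => if r.1 = t then g r.2 else 0) := by
  simp only [SumCode.combine, SumCode.combineAll, AddMonoidHom.mk'_apply, Fintype.sum_prod_type]
  rw [Finset.sum_eq_single t]
  · simp
  · intro t' _ ht'
    simp [ht']
  · simp

variable (c₁ : SumCode G W E srv Y₁) (c₂ : SumCode G W E srv Y₂)

omit [Fintype G] [DecidableEq G] [DecidableEq I] [Fintype Y₁] [DecidableEq Y₂] in
theorem syndromeAll_combineAll (horth : ∀ t l t' l', c₁.check t l ⬝ᵥ c₂.check t' l' = 0)
    (g : Fin T × Y₂ → G) : c₁.syndromeAll (restrictAll srv (c₂.combineAll g)) = 0 := by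
  ext r
  change pairAll srv (c₁.check r.1 r.2) (restrictAll srv (∑ r, g r • c₂.check r.1 r.2)) = 0
  rw [pairAll_restrictAll, dotProduct_sum]
  refine Finset.sum_eq_zero fun r' _ => ?_
  rw [dotProduct_smul, horth, smul_zero]

omit [Fintype G] [DecidableEq G] [DecidableEq I] [Fintype Y₁] [DecidableEq Y₂] in
theorem syndromeJoint_combine (horth : ∀ t l t' l', c₁.check t l ⬝ᵥ c₂.check t' l' = 0)
    (t : Fin T) (g : Y₂ → G) :
    c₁.syndromeJoint t (restrictJoint srv (E t) (c₂.combine t g)) = 0 := by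
  ext l
  have h := congrFun (syndromeAll_combineAll c₁ c₂ horth
    (fun r => if r.1 = t then g r.2 else 0)) (t, l)
  rw [← c₂.combine_eq_combineAll] at h
  exact (pairJoint_eq_pairAll srv (E t) _ (c₁.check_eq_zero t l) _).trans h

/-- The shared state: maximally mixed on the space of the vectors that are supported on the words
with trivial syndrome for `c₁` and are invariant under translation by all checks of `c₂`. -/
def cssState : Matrix (AllSymbols G srv) (AllSymbols G srv) ℂ :=
  (cssMatrix c₁.syndromeAll ((restrictAll srv).comp c₂.combineAll) 0 1).trace⁻¹ •
    cssMatrix c₁.syndromeAll ((restrictAll srv).comp c₂.combineAll) 0 1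

theorem isDensity_cssState (horth : ∀ t l t' l', c₁.check t l ⬝ᵥ c₂.check t' l' = 0) :
    IsDensity (cssState c₁ c₂) := by
  have hp := cssMatrix_posSemidef c₁.syndromeAll ((restrictAll srv).comp c₂.combineAll)
    (syndromeAll_combineAll c₁ c₂ horth) 0 1
  refine ⟨hp.smul (inv_nonneg.mpr hp.trace_nonneg), ?_⟩
  rw [cssState, Matrix.trace_smul, smul_eq_mul, inv_mul_cancel₀ (trace_cssMatrix_ne_zero _ _)]

theorem IsDensity.submatrix {m n : Type*} [Fintype m] [Fintype n] {ρ : Matrix m m ℂ}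
    (hρ : IsDensity ρ) (e : n ≃ m) : IsDensity (ρ.submatrix e e) :=
  ⟨hρ.1.submatrix e, (Equiv.sum_comp e fun i => ρ i i).trans hρ.2⟩

/-- Translation by `-a` of the symbols of one server. -/
def localShift (s : Fin (S + 1)) (a : LocalSymbols G srv s) :
    Fin (symbolDim G srv s) ≃ Fin (symbolDim G srv s) :=
  ((symbolEquiv G srv s).trans (Equiv.subRight a)).trans (symbolEquiv G srv s).symm

/-- The phases `χ (b ⬝ᵥ x)` that one server applies to its basis states. -/
def localPhase (χ : AddChar G ℂ) (s : Fin (S + 1)) (b : LocalSymbols G srv s)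
    (j : Fin (symbolDim G srv s)) : ℂ :=
  χ (b ⬝ᵥ symbolEquiv G srv s j)

theorem addChar_mul_star_self {A : Type*} [AddCommGroup A] [Finite A] (χ : AddChar A ℂ) (a : A) :
    χ a * star (χ a) = 1 := by
  rw [← starRingEnd_apply, ← AddChar.map_neg_eq_conj, ← AddChar.map_add_eq_mul, add_neg_cancel,
    AddChar.map_zero_eq_one]

theorem addChar_map_finset_sum {A ι : Type*} [AddCommGroup A] (χ : AddChar A ℂ) (s : Finset ι)
    (f : ι → A) : χ (∑ i ∈ s, f i) = ∏ i ∈ s, χ (f i) := by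
  classical
  induction s using Finset.induction_on with
  | empty => simp
  | insert a s ha ih => rw [Finset.sum_insert ha, Finset.prod_insert ha, AddChar.map_add_eq_mul, ih]

variable (θ : (Fin L → F) ≃+ (Y₁ → G) × (Y₂ → G)) {χ : AddChar G ℂ}

/-- The measurement for the erasure pattern `t`: it measures the checks of `c₁` in the standard
basis and, simultaneously, the translations by the checks of `c₂`. -/
theorem isPOVM_cssMatrix (hχ : χ ≠ 1) (horth : ∀ t l t' l', c₁.check t l ⬝ᵥ c₂.check t' l' = 0)
    (t : Fin T) :
    IsPOVM fun y : Fin L → F => ((Fintype.card (Y₂ → G) : ℂ)⁻¹ • cssMatrix (c₁.syndromeJoint t)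
      ((restrictJoint srv (E t)).comp (c₂.combine t)) (θ y).1 (dotChar χ (θ y).2)).submatrix
      (jointEquiv G srv (E t)) (jointEquiv G srv (E t)) where
  posSemidef y := ((cssMatrix_posSemidef _ _ (syndromeJoint_combine c₁ c₂ horth t) _ _).smul
    (inv_nonneg.mpr (by exact_mod_cast Nat.zero_le _))).submatrix _
  sum_eq_one := by
    classical
    have hU : (Fintype.card (Y₂ → G) : ℂ) ≠ 0 := by exact_mod_cast Fintype.card_ne_zero
    have h := sum_cssMatrix (c₁.syndromeJoint t) ((restrictJoint srv (E t)).comp (c₂.combine t))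
      (dotChar χ) (sum_dotChar hχ)
    rw [← θ.toEquiv.sum_comp] at h
    have h2 := congrArg (fun M => ((Fintype.card (Y₂ → G) : ℂ)⁻¹ • M).submatrix
      (jointEquiv G srv (E t)) (jointEquiv G srv (E t))) h
    simp only [smul_smul, inv_mul_cancel₀ hU, one_smul, Matrix.submatrix_one_equiv] at h2
    rw [← h2]
    ext p q
    simp [Matrix.sum_apply, Finset.mul_sum]

/-- The coding scheme of a pair of orthogonal sum codes.  The batch `w` is relabelled by `θ` as a
pair; its first component is encoded by `c₁` as a translation (an `X`-type error), its second one by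
`c₂` as a phase (a `Z`-type error), and the receiver reads both syndromes. -/
def cssScheme (hχ : χ ≠ 1) (horth : ∀ t l t' l', c₁.check t l ⬝ᵥ c₂.check t' l' = 0) :
    Scheme F W E L where
  dim := symbolDim G srv
  dim_pos _ := Fintype.card_pos
  initDim s := symbolDim G srv s.succ
  init := (cssState c₁ c₂).submatrix (allEquiv G srv) (allEquiv G srv)
  init_density := (isDensity_cssState c₁ c₂ horth).submatrix _
  enc s x := monomialMap (localPhase χ s.succ (c₂.localEnc (fun y => (θ y).2) s x))
    (localShift s.succ (c₁.localEnc (fun y => (θ y).1) s x))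
  enc_channel _ _ := isChannel_monomialMap (fun _ => addChar_mul_star_self χ _) _
  dec t y := ((Fintype.card (Y₂ → G) : ℂ)⁻¹ • cssMatrix (c₁.syndromeJoint t)
      ((restrictJoint srv (E t)).comp (c₂.combine t)) (θ y).1 (dotChar χ (θ y).2)).submatrix
      (jointEquiv G srv (E t)) (jointEquiv G srv (E t))
  dec_povm := isPOVM_cssMatrix c₁ c₂ θ hχ horth

variable (hχ : χ ≠ 1) (horth : ∀ t l t' l', c₁.check t l ⬝ᵥ c₂.check t' l' = 0)

variable (χ) in
/-- The state after encoding: `cssState` conjugated by the translation by the total codeword of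
`c₁` and by the phases of the total codeword of `c₂`. -/
def cssEncoded (w : Fin K → Fin L → F) :
    Matrix (JointIndex (symbolDim G srv 0) fun s : Fin S => symbolDim G srv s.succ)
      (JointIndex (symbolDim G srv 0) fun s : Fin S => symbolDim G srv s.succ) ℂ :=
  Matrix.of fun p q =>
    χ (pairAll srv (c₂.totalEnc (fun y => (θ y).2) w) (allEquiv G srv p)) *
      star (χ (pairAll srv (c₂.totalEnc (fun y => (θ y).2) w) (allEquiv G srv q))) *
      cssState c₁ c₂ (allEquiv G srv p - restrictAll srv (c₁.totalEnc (fun y => (θ y).1) w))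
        (allEquiv G srv q - restrictAll srv (c₁.totalEnc (fun y => (θ y).1) w))

theorem cssScheme_encoded (w : Fin K → Fin L → F) :
    (cssScheme c₁ c₂ θ hχ horth).encoded w = cssEncoded c₁ c₂ θ χ w := by
  have hphase : ∀ p : JointIndex (symbolDim G srv 0) fun s : Fin S => symbolDim G srv s.succ,
      ∏ s, localPhase χ s.succ (c₂.localEnc (fun y => (θ y).2) s (localData W w s)) (p.2 s) =
      χ (pairAll srv (c₂.totalEnc (fun y => (θ y).2) w) (allEquiv G srv p)) := by
    intro p
    simp only [c₂.localEnc_localData, localPhase]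
    rw [← addChar_map_finset_sum]
    congr 1
    change _ = ∑ i : {i // srv i = 0}, c₂.totalEnc (fun y => (θ y).2) w i.1 * _ + _
    rw [Finset.sum_eq_zero (s := (Finset.univ : Finset {i // srv i = 0})), zero_add]
    · rfl
    · intro i _
      rw [c₂.totalEnc_server_zero _ _ _ i.2, zero_mul]
  have hshift : ∀ p : JointIndex (symbolDim G srv 0) fun s : Fin S => symbolDim G srv s.succ,
      allEquiv G srv (p.1, fun s =>
        localShift s.succ (c₁.localEnc (fun y => (θ y).1) s (localData W w s)) (p.2 s)) =
      allEquiv G srv p - restrictAll srv (c₁.totalEnc (fun y => (θ y).1) w) := by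
    intro p
    refine Prod.ext (funext fun i => ?_) (funext fun s => ?_)
    · change symbolEquiv G srv 0 p.1 i =
        symbolEquiv G srv 0 p.1 i - c₁.totalEnc (fun y => (θ y).1) w i.1
      rw [c₁.totalEnc_server_zero _ _ _ i.2, sub_zero]
    · simp only [c₁.localEnc_localData]
      simp [allEquiv, localShift]
  have hentry : ∀ p q : JointIndex (symbolDim G srv 0) fun s : Fin S => symbolDim G srv s.succ,
      applyLocal (fun s => monomialMap
        (localPhase χ s.succ (c₂.localEnc (fun y => (θ y).2) s (localData W w s)))
        (localShift s.succ (c₁.localEnc (fun y => (θ y).1) s (localData W w s))))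
        ((cssState c₁ c₂).submatrix (allEquiv G srv) (allEquiv G srv)) p q =
      cssEncoded c₁ c₂ θ χ w p q := by
    intro p q
    rw [applyLocal_monomialMap, Finset.prod_mul_distrib, hphase, ← star_prod, hphase,
      Matrix.submatrix_apply, hshift, hshift]
    rfl
  exact Matrix.ext hentry

variable (χ)

include horth in
omit [Fintype F] in
/-- The received state has the sum of the second components as its phase syndrome. -/
theorem dotChar_mul_traceOut_cssEncoded (w : Fin K → Fin L → F) (t : Fin T)
    (p : JointIndex (symbolDim G srv 0)
      (fun s : {s : Fin S // s ∉ E t} => symbolDim G srv s.1.succ)) (g : Y₂ → G) :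
    dotChar χ (θ (∑ k, w k)).2 g * traceOut (E t) (cssEncoded c₁ c₂ θ χ w)
        ((jointEquiv G srv (E t)).symm
          (jointEquiv G srv (E t) p - restrictJoint srv (E t) (c₂.combine t g))) p =
      traceOut (E t) (cssEncoded c₁ c₂ θ χ w) p p := by
  have hθ₂ : (∑ k, (θ (w k)).2) = (θ (∑ k, w k)).2 := by rw [map_sum, Prod.snd_sum]
  simp only [traceOut, Matrix.of_apply, cssEncoded]
  rw [Finset.mul_sum]
  refine Finset.sum_congr rfl fun e _ => ?_
  rw [allEquiv_glue_sub srv (E t) _ (fun i s hs hi => c₂.combine_eq_zero t g i s hs hi)]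
  set X := allEquiv G srv (p.1, glue (E t) p.2 e)
  set a := restrictAll srv (c₁.totalEnc (fun y => (θ y).1) w)
  have hstate : cssState c₁ c₂ (X - restrictAll srv (c₂.combine t g) - a) (X - a) =
      cssState c₁ c₂ (X - a) (X - a) := by
    rw [c₂.combine_eq_combineAll, sub_right_comm, cssState, Matrix.smul_apply,
      Matrix.smul_apply]
    congr 1
    exact cssMatrix_sub_left _ ((restrictAll srv).comp c₂.combineAll)
      (syndromeAll_combineAll c₁ c₂ horth) _ _ _
  have hpair : pairAll srv (c₂.totalEnc (fun y => (θ y).2) w)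
      (restrictAll srv (c₂.combine t g)) = g ⬝ᵥ (θ (∑ k, w k)).2 := by
    rw [pairAll_restrictAll, dotProduct_comm, ← hθ₂]
    change (∑ l, g l • c₂.check t l) ⬝ᵥ _ = _
    rw [sum_dotProduct]
    refine Finset.sum_congr rfl fun l _ => ?_
    rw [smul_dotProduct, c₂.check_dotProduct_totalEnc, smul_eq_mul]
  rw [hstate, map_sub, hpair, dotChar_apply, sub_eq_add_neg, AddChar.map_add_eq_mul,
    AddChar.map_neg_eq_conj, starRingEnd_apply]
  have h1 := addChar_mul_star_self χ (g ⬝ᵥ (θ (∑ k, w k)).2)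
  linear_combination (χ (pairAll srv (c₂.totalEnc (fun y => (θ y).2) w) X) *
    star (χ (pairAll srv (c₂.totalEnc (fun y => (θ y).2) w) X)) *
    cssState c₁ c₂ (X - a) (X - a)) * h1

omit [Fintype F] in
/-- The received state has the sum of the first components as its translation syndrome. -/
theorem syndromeJoint_of_traceOut_cssEncoded_ne_zero (w : Fin K → Fin L → F) (t : Fin T)
    (p : JointIndex (symbolDim G srv 0)
      (fun s : {s : Fin S // s ∉ E t} => symbolDim G srv s.1.succ))
    (hp : traceOut (E t) (cssEncoded c₁ c₂ θ χ w) p p ≠ 0) :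
    c₁.syndromeJoint t (jointEquiv G srv (E t) p) = (θ (∑ k, w k)).1 := by
  have hθ₁ : (∑ k, (θ (w k)).1) = (θ (∑ k, w k)).1 := by rw [map_sum, Prod.fst_sum]
  obtain ⟨e, -, he⟩ := Finset.exists_ne_zero_of_sum_ne_zero hp
  have h0 := right_ne_zero_of_mul he
  simp only [cssState, Matrix.smul_apply, cssMatrix, Matrix.of_apply, smul_eq_mul] at h0
  have h1 := (ite_ne_right_iff.mp (right_ne_zero_of_mul h0)).1
  rw [map_sub, sub_eq_zero] at h1
  ext l
  rw [← hθ₁, ← c₁.check_dotProduct_totalEnc (fun y => (θ y).1), ← pairAll_restrictAll srv,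
    jointEquiv_eq srv (E t) p e]
  exact (pairJoint_eq_pairAll srv (E t) _ (c₁.check_eq_zero t l) _).trans (congrFun h1 (t, l))

include horth in
omit [Fintype F] in
theorem trace_cssEncoded (w : Fin K → Fin L → F) : (cssEncoded c₁ c₂ θ χ w).trace = 1 := by
  simp only [Matrix.trace, Matrix.diag_apply, cssEncoded, Matrix.of_apply,
    addChar_mul_star_self, one_mul]
  rw [← (isDensity_cssState c₁ c₂ horth).2]
  exact ((allEquiv G srv).trans (Equiv.subRight
    (restrictAll srv (c₁.totalEnc (fun y => (θ y).1) w)))).sum_comp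
    fun p => cssState c₁ c₂ p p

variable {χ}

theorem cssScheme_correct : (cssScheme c₁ c₂ θ hχ horth).Correct := by
  intro w t
  have h := trace_cssMatrix_mul_eq_one (jointEquiv G srv (E t)) (c₁.syndromeJoint t)
    ((restrictJoint srv (E t)).comp (c₂.combine t)) (θ (∑ k, w k)).1
    (dotChar χ (θ (∑ k, w k)).2) (traceOut (E t) (cssEncoded c₁ c₂ θ χ w))
    (dotChar_mul_traceOut_cssEncoded c₁ c₂ θ χ horth w t)
    (syndromeJoint_of_traceOut_cssEncoded_ne_zero c₁ c₂ θ χ w t)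
    ((trace_traceOut _ _).trans (trace_cssEncoded c₁ c₂ θ χ horth w))
  rw [Scheme.received, cssScheme_encoded]
  exact h

end Realization

/-! ### Generalized Reed-Solomon sum codes -/

section ReedSolomon
open Polynomial

variable {G : Type*} [Field G] {S K T : ℕ} {I : Type*} [Fintype I] [DecidableEq I]

/-- The symbols that belong to the data-servers in `A`. -/
def held (srv : I → Fin (S + 1)) (A : Finset (Fin S)) : Finset I :=
  Finset.univ.filter fun i => ∃ s ∈ A, srv i = s.succ

omit [DecidableEq I] in
theorem card_held (srv : I → Fin (S + 1)) (A : Finset (Fin S)) :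
    (held srv A).card = ∑ s ∈ A, Fintype.card {i // srv i = s.succ} := by
  classical
  have h : held srv A = A.biUnion fun s => Finset.univ.filter fun i => srv i = s.succ := by
    ext i; simp [held]
  rw [h, Finset.card_biUnion]
  · simp [Fintype.card_subtype]
  · intro s _ s' _ hss'
    rw [Function.onFun, Finset.disjoint_filter]
    intro i _ h1 h2
    exact hss' (Fin.succ_injective _ (h1.symm.trans h2))

/-- The polynomial that vanishes at the nodes of the symbols in `A` and takes the value `1` at
`β l` and `0` at the other nodes of the data. -/
def decodingPoly {L : ℕ} (α : I → G) (β : Fin L → G) (A : Finset I) (l : Fin L) : G[X] :=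
  Lagrange.nodal A α * (C (eval (β l) (Lagrange.nodal A α))⁻¹ * Lagrange.basis Finset.univ β l)

variable {L : ℕ} {α : I → G} {β : Fin L → G}

omit [Fintype I] [DecidableEq I] in
theorem eval_decodingPoly_node (A : Finset I) (l : Fin L) {i : I} (hi : i ∈ A) :
    eval (α i) (decodingPoly α β A l) = 0 := by
  rw [decodingPoly, eval_mul, Lagrange.eval_nodal_at_node hi, zero_mul]

omit [Fintype I] [DecidableEq I] in
theorem eval_decodingPoly (hβ : Function.Injective β) (hαβ : ∀ i l, β l ≠ α i) (A : Finset I)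
    (l m : Fin L) : eval (β m) (decodingPoly α β A l) = if m = l then 1 else 0 := by
  rw [decodingPoly, eval_mul, eval_mul, eval_C]
  split_ifs with h
  · subst h
    rw [Lagrange.eval_basis_self hβ.injOn (Finset.mem_univ _), mul_one, mul_inv_cancel₀]
    exact Lagrange.eval_nodal_not_at_node fun i _ => hαβ i m
  · rw [Lagrange.eval_basis_of_ne (Ne.symm h) (Finset.mem_univ _), mul_zero, mul_zero]

omit [Fintype I] [DecidableEq I] in
theorem natDegree_decodingPoly_lt (hβ : Function.Injective β) {A : Finset I} {n : ℕ}
    (hA : A.card ≤ n) (l : Fin L) : (decodingPoly α β A l).natDegree < n + L := by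
  have h1 : (decodingPoly α β A l).natDegree ≤ A.card + (0 + (L - 1)) := by
    refine natDegree_mul_le_of_le (Lagrange.natDegree_nodal).le
      (natDegree_mul_le_of_le (natDegree_C _).le ?_)
    rw [Lagrange.natDegree_basis hβ.injOn (Finset.mem_univ _), Finset.card_univ, Fintype.card_fin]
  have := l.pos
  omega

/-- The sum code whose checks are the generalized Reed-Solomon words
`(v i * D (α i))_i` with `D` the decoding polynomials.  All `D` have degree less than `n + L`.  A stream
`w` defines the functional `D ↦ ∑ m, w m * D (β m)` on such polynomials, and Lagrange interpolation
at the at least `n + L` nodes of any `W k` writes this functional in terms of the symbols of the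
servers in `W k`.  All streams realize it by the same formula, so the receiver gets the sum. -/
def reedSolomon {W : Fin K → Finset (Fin S)} {E : Fin T → Finset (Fin S)} {srv : I → Fin (S + 1)}
    {v : I → G} (hv : ∀ i, v i ≠ 0) (hα : Function.Injective α) (hβ : Function.Injective β)
    (hαβ : ∀ i l, β l ≠ α i) {n : ℕ} (hE : ∀ t, (held srv (E t)).card ≤ n)
    (hW : ∀ k, n + L ≤ (held srv (W k)).card) : SumCode G W E srv (Fin L) where
  enc k w i := if i ∈ held srv (W k) then
    (v i)⁻¹ * ∑ m, w m * eval (β m) (Lagrange.basis (held srv (W k)) α i) else 0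
  enc_eq_zero k w i hi := if_neg fun h => by
    obtain ⟨s, hs, h⟩ := (Finset.mem_filter.mp h).2
    exact hi s hs h
  check t l i := v i * eval (α i) (decodingPoly α β (held srv (E t)) l)
  check_eq_zero t l i s hs hi := by
    rw [eval_decodingPoly_node, mul_zero]
    exact Finset.mem_filter.mpr ⟨Finset.mem_univ _, s, hs, hi⟩
  check_dotProduct_enc t l k w := by
    set D := decodingPoly α β (held srv (E t)) l with hD
    have hdeg : D.degree < (held srv (W k)).card := by
      refine degree_le_natDegree.trans_lt ?_
      exact_mod_cast (natDegree_decodingPoly_lt hβ (hE t) l).trans_le (hW k)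
    have hint : ∀ m, eval (β m) D = ∑ i ∈ held srv (W k),
        eval (α i) D * eval (β m) (Lagrange.basis (held srv (W k)) α i) := by
      intro m
      conv_lhs => rw [Lagrange.eq_interpolate hα.injOn hdeg, Lagrange.interpolate_apply]
      rw [eval_finsetSum]
      exact Finset.sum_congr rfl fun i _ => by rw [eval_mul, eval_C]
    calc ∑ i, v i * eval (α i) D * (if i ∈ held srv (W k) then
          (v i)⁻¹ * ∑ m, w m * eval (β m) (Lagrange.basis (held srv (W k)) α i) else 0)
        = ∑ i ∈ held srv (W k), ∑ m, w m *
          (eval (α i) D * eval (β m) (Lagrange.basis (held srv (W k)) α i)) := by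
          simp only [mul_ite, mul_zero, Finset.sum_ite_mem, Finset.univ_inter]
          refine Finset.sum_congr rfl fun i _ => ?_
          rw [mul_comm (v i), mul_assoc, mul_inv_cancel_left₀ (hv i), Finset.mul_sum]
          exact Finset.sum_congr rfl fun m _ => by ring
      _ = ∑ m, w m * eval (β m) D := by
          rw [Finset.sum_comm]
          simp only [hint, Finset.mul_sum]
      _ = w l := by
          simp [hD, eval_decodingPoly hβ hαβ]

/-- A Reed-Solomon code is orthogonal to the one twisted by the nodal weights when the two
dimensions add up to at most the length: the inner product of the words of `D` and `D'` is the top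
coefficient in the Lagrange interpolation of `D * D'`, whose degree is too small. -/
theorem reedSolomon_orthogonal {W : Fin K → Finset (Fin S)} {E : Fin T → Finset (Fin S)}
    {srv : I → Fin (S + 1)} (hα : Function.Injective α)
    (hβ : Function.Injective β) (hαβ : ∀ i l, β l ≠ α i) {n : ℕ}
    (hE : ∀ t, (held srv (E t)).card ≤ n) (hW : ∀ k, n + L ≤ (held srv (W k)).card)
    (hI : 2 * (n + L) ≤ Fintype.card I)
    (h₁ : ∀ i : I, (1 : I → G) i ≠ 0) (h₂ : ∀ i, Lagrange.nodalWeight Finset.univ α i ≠ 0)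
    (t : Fin T) (l : Fin L) (t' : Fin T) (l' : Fin L) :
    (reedSolomon (W := W) (E := E) h₁ hα hβ hαβ hE hW).check t l ⬝ᵥ
      (reedSolomon (W := W) (E := E) h₂ hα hβ hαβ hE hW).check t' l' = 0 := by
  set D := decodingPoly α β (held srv (E t)) l
  set D' := decodingPoly α β (held srv (E t')) l'
  have hdeg : (D * D').natDegree + 2 ≤ 2 * (n + L) := by
    have h1 : D.natDegree < n + L := natDegree_decodingPoly_lt hβ (hE t) l
    have h2 : D'.natDegree < n + L := natDegree_decodingPoly_lt hβ (hE t') l'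
    have h3 : (D * D').natDegree ≤ D.natDegree + D'.natDegree := natDegree_mul_le
    omega
  have hlt : (D * D').degree < (Finset.univ : Finset I).card := by
    refine degree_le_natDegree.trans_lt ?_
    rw [Finset.card_univ]
    exact_mod_cast (by omega)
  have h := Lagrange.coeff_eq_sum hα.injOn hlt
  rw [coeff_eq_zero_of_natDegree_lt (by rw [Finset.card_univ]; omega)] at h
  rw [h]
  refine Finset.sum_congr rfl fun i _ => ?_
  change 1 * eval (α i) D * (Lagrange.nodalWeight Finset.univ α i * eval (α i) D') = _
  rw [Lagrange.nodalWeight, Finset.prod_inv_distrib, eval_mul]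
  ring

end ReedSolomon

/-! ### Direct sums of sum codes -/

section Combine

variable {G : Type*} [Field G] {S K T : ℕ} {W : Fin K → Finset (Fin S)}
  {E : Fin T → Finset (Fin S)} {I I' : Type*} [Fintype I] [Fintype I'] {srv : I → Fin (S + 1)}
  {srv' : I' → Fin (S + 1)} {Y Y' : Type*}

/-- The zero code, for which there is nothing to decode. -/
def SumCode.ofIsEmpty (h : IsEmpty (Fin K × Fin T × Y)) : SumCode G W E srv Y where
  enc _ _ := 0
  enc_eq_zero _ _ _ _ := rfl
  check _ _ := 0
  check_eq_zero _ _ _ _ _ _ := rfl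
  check_dotProduct_enc t l k _ := h.elim (k, t, l)

/-- Two sum codes side by side, on separate symbols and separate data. -/
def SumCode.directSum (c : SumCode G W E srv Y) (c' : SumCode G W E srv' Y') :
    SumCode G W E (Sum.elim srv srv') (Y ⊕ Y') where
  enc k w := Sum.elim (c.enc k (w ∘ Sum.inl)) (c'.enc k (w ∘ Sum.inr))
  enc_eq_zero k w i hi := by
    cases i with
    | inl i => exact c.enc_eq_zero _ _ _ hi
    | inr i => exact c'.enc_eq_zero _ _ _ hi
  check t := Sum.elim (fun l => Sum.elim (c.check t l) 0) (fun l => Sum.elim 0 (c'.check t l))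
  check_eq_zero t l i s hs hi := by
    cases l with
    | inl l => cases i with
      | inl i => exact c.check_eq_zero _ _ _ s hs hi
      | inr i => rfl
    | inr l => cases i with
      | inl i => rfl
      | inr i => exact c'.check_eq_zero _ _ _ s hs hi
  check_dotProduct_enc t l k w := by
    cases l with
    | inl l => simp [c.check_dotProduct_enc]
    | inr l => simp [c'.check_dotProduct_enc]

theorem SumCode.directSum_orthogonal {Y₁ Y₂ Y₁' Y₂' : Type*}
    {c₁ : SumCode G W E srv Y₁} {c₂ : SumCode G W E srv Y₂}
    {c₁' : SumCode G W E srv' Y₁'} {c₂' : SumCode G W E srv' Y₂'}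
    (h : ∀ t l t' l', c₁.check t l ⬝ᵥ c₂.check t' l' = 0)
    (h' : ∀ t l t' l', c₁'.check t l ⬝ᵥ c₂'.check t' l' = 0) (t : Fin T) (l : Y₁ ⊕ Y₁')
    (t' : Fin T) (l' : Y₂ ⊕ Y₂') :
    (c₁.directSum c₁').check t l ⬝ᵥ (c₂.directSum c₂').check t' l' = 0 := by
  cases l <;> cases l' <;> simp [SumCode.directSum, h, h']

end Combine

/-! ### Pairs of orthogonal codes over all large fields -/

section HasCodes

variable {S K T : ℕ}

/-- Over every sufficiently large finite field there is a pair of orthogonal sum codes with `N s`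
symbols at the server `s` and `L` data symbols per stream in total.  Fields and index sets in `Type`
suffice, whatever the universe of the data field. -/
def HasCSSCodes (W : Fin K → Finset (Fin S)) (E : Fin T → Finset (Fin S)) (N : Fin (S + 1) → ℕ)
    (L : ℕ) : Prop :=
  ∃ q₀ : ℕ, ∀ (G : Type) [Field G] [Fintype G], q₀ ≤ Fintype.card G →
    ∃ (I : Type) (_ : Fintype I) (srv : I → Fin (S + 1)) (Y₁ Y₂ : Type) (_ : Fintype Y₁)
      (_ : Fintype Y₂) (c₁ : SumCode G W E srv Y₁) (c₂ : SumCode G W E srv Y₂),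
      (∀ s, Fintype.card {i // srv i = s} = N s) ∧ Fintype.card Y₁ + Fintype.card Y₂ = L ∧
      ∀ t l t' l', c₁.check t l ⬝ᵥ c₂.check t' l' = 0

variable {W : Fin K → Finset (Fin S)} {E : Fin T → Finset (Fin S)} {N N' : Fin (S + 1) → ℕ}
  {L L' : ℕ}

theorem card_sigma_fst_eq (N : Fin (S + 1) → ℕ) (s : Fin (S + 1)) :
    Fintype.card {i : Σ s, Fin (N s) // i.1 = s} = N s := by
  rw [Fintype.card_congr (Equiv.sigmaSubtype (β := fun s => Fin (N s)) s), Fintype.card_fin]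

theorem HasCSSCodes.of_isEmpty (h : IsEmpty (Fin K × Fin T × Fin L)) (N : Fin (S + 1) → ℕ) :
    HasCSSCodes W E N L :=
  ⟨0, fun G _ _ _ => ⟨Σ s, Fin (N s), inferInstance, Sigma.fst, Fin L, Empty, inferInstance,
    inferInstance, SumCode.ofIsEmpty h, SumCode.ofIsEmpty inferInstance, card_sigma_fst_eq N,
    by simp, fun _ _ _ l' => l'.elim⟩⟩

theorem HasCSSCodes.add (h : HasCSSCodes W E N L) (h' : HasCSSCodes W E N' L') :
    HasCSSCodes W E (N + N') (L + L') := by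
  obtain ⟨q, hq⟩ := h
  obtain ⟨q', hq'⟩ := h'
  refine ⟨max q q', fun G _ _ hG => ?_⟩
  obtain ⟨I, _, srv, Y₁, Y₂, _, _, c₁, c₂, hN, hL, h⟩ := hq G ((le_max_left _ _).trans hG)
  obtain ⟨I', _, srv', Y₁', Y₂', _, _, c₁', c₂', hN', hL', h'⟩ :=
    hq' G ((le_max_right _ _).trans hG)
  refine ⟨I ⊕ I', inferInstance, Sum.elim srv srv', Y₁ ⊕ Y₁', Y₂ ⊕ Y₂', inferInstance,
    inferInstance, c₁.directSum c₁', c₂.directSum c₂', fun s => ?_, ?_,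
    SumCode.directSum_orthogonal h h'⟩
  · rw [Pi.add_apply, ← hN, ← hN', ← Fintype.card_sum]
    exact Fintype.card_congr Equiv.subtypeSum
  · rw [← hL, ← hL', Fintype.card_sum, Fintype.card_sum]
    ring

theorem HasCSSCodes.mono (h : HasCSSCodes W E N L) (hN : N ≤ N') : HasCSSCodes W E N' L := by
  have := h.add (HasCSSCodes.of_isEmpty (L := 0) inferInstance (N' - N))
  rwa [add_tsub_cancel_of_le hN] at this

theorem card_held_sigma_fst (N : Fin (S + 1) → ℕ) (A : Finset (Fin S)) :
    (held (Sigma.fst : (Σ s, Fin (N s)) → Fin (S + 1)) A).card = ∑ s ∈ A, N s.succ := by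
  rw [card_held]
  exact Finset.sum_congr rfl fun s _ => card_sigma_fst_eq N s.succ

theorem exists_nodes {G : Type*} [Fintype G] {N : Fin (S + 1) → ℕ} {L : ℕ}
    (hG : ∑ s, N s + L ≤ Fintype.card G) :
    ∃ (α : (Σ s, Fin (N s)) → G) (β : Fin L → G), Function.Injective α ∧ Function.Injective β ∧
      ∀ i l, β l ≠ α i := by
  obtain ⟨f⟩ : Nonempty ((Σ s, Fin (N s)) ⊕ Fin L ↪ G) :=
    Function.Embedding.nonempty_of_card_le (by simpa using hG)
  exact ⟨fun i => f (Sum.inl i), fun l => f (Sum.inr l),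
    fun i j h => Sum.inl_injective (f.injective h), fun i j h => Sum.inr_injective (f.injective h),
    fun i l h => Sum.inr_ne_inl (f.injective h)⟩

/-- One Reed-Solomon code, with an empty partner: every qudit serves as a classical dit. -/
theorem HasCSSCodes.of_classical {n : ℕ} (hE : ∀ t, ∑ s ∈ E t, N s.succ ≤ n)
    (hW : ∀ k, n + L ≤ ∑ s ∈ W k, N s.succ) : HasCSSCodes W E N L := by
  refine ⟨∑ s, N s + L, fun G _ _ hG => ?_⟩
  obtain ⟨α, β, hα, hβ, hαβ⟩ := exists_nodes hG
  refine ⟨Σ s, Fin (N s), inferInstance, Sigma.fst, Fin L, Empty, inferInstance, inferInstance,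
    reedSolomon (v := 1) (fun _ => one_ne_zero) hα hβ hαβ (n := n) (fun t => ?_) (fun k => ?_),
    SumCode.ofIsEmpty inferInstance, card_sigma_fst_eq N, by simp, fun _ _ _ l' => l'.elim⟩
  · rw [card_held_sigma_fst]; exact hE t
  · rw [card_held_sigma_fst]; exact hW k

/-- Two orthogonal Reed-Solomon codes: every qudit carries a translation and a phase. -/
theorem HasCSSCodes.of_quantum {n : ℕ} (hE : ∀ t, ∑ s ∈ E t, N s.succ ≤ n)
    (hW : ∀ k, n + L ≤ ∑ s ∈ W k, N s.succ) (hN : 2 * (n + L) ≤ ∑ s, N s) :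
    HasCSSCodes W E N (2 * L) := by
  refine ⟨∑ s, N s + L, fun G _ _ hG => ?_⟩
  obtain ⟨α, β, hα, hβ, hαβ⟩ := exists_nodes hG
  have hE' : ∀ t, (held (Sigma.fst : (Σ s, Fin (N s)) → Fin (S + 1)) (E t)).card ≤ n := fun t => by
    rw [card_held_sigma_fst]; exact hE t
  have hW' : ∀ k, n + L ≤ (held (Sigma.fst : (Σ s, Fin (N s)) → Fin (S + 1)) (W k)).card :=
    fun k => by rw [card_held_sigma_fst]; exact hW k
  refine ⟨Σ s, Fin (N s), inferInstance, Sigma.fst, Fin L, Fin L, inferInstance, inferInstance,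
    reedSolomon (v := 1) (fun _ => one_ne_zero) hα hβ hαβ hE' hW',
    reedSolomon (fun i => Lagrange.nodalWeight_ne_zero hα.injOn (Finset.mem_univ i))
      hα hβ hαβ hE' hW', card_sigma_fst_eq N, ?_,
    reedSolomon_orthogonal hα hβ hαβ hE' hW' (by simpa using hN) _ _⟩
  rw [Fintype.card_fin, two_mul]

/-- For every `z > 0` there is a field with `|F| ^ z` elements and the same characteristic, so that batches
over `F` can be relabelled additively as batches over the larger field that are `z` times
shorter. -/
theorem exists_field_addEquiv (F : Type*) [Field F] [Fintype F] {z : ℕ} (hz : z ≠ 0) :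
    ∃ (G : Type) (_ : Field G) (_ : Fintype G), Fintype.card G = Fintype.card F ^ z ∧
      ∀ (Y₁ Y₂ : Type) [Fintype Y₁] [Fintype Y₂],
        Nonempty ((Fin (z * (Fintype.card Y₁ + Fintype.card Y₂)) → F) ≃+ (Y₁ → G) × (Y₂ → G)) := by
  classical
  let p := ringChar F
  have : Fact p.Prime := ⟨CharP.char_is_prime F p⟩
  let _ : Algebra (ZMod p) F := ZMod.algebra F p
  have hF : Fintype.card F = p ^ Module.finrank (ZMod p) F := by
    rw [Module.card_eq_pow_finrank (K := ZMod p), ZMod.card]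
  have hr : Module.finrank (ZMod p) F ≠ 0 := Module.finrank_pos.ne'
  let G := GaloisField p (Module.finrank (ZMod p) F * z)
  let _ : Fintype G := Fintype.ofFinite G
  have hG : Module.finrank (ZMod p) G = Module.finrank (ZMod p) F * z :=
    GaloisField.finrank p (mul_ne_zero hr hz)
  refine ⟨G, inferInstance, inferInstance, ?_, fun Y₁ Y₂ _ _ => ?_⟩
  · rw [Module.card_eq_pow_finrank (K := ZMod p) (V := G), ZMod.card, hG, hF, pow_mul]
  · obtain ⟨e⟩ := FiniteDimensional.nonempty_linearEquiv_of_finrank_eq (R := ZMod p)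
      (M := Fin (z * (Fintype.card Y₁ + Fintype.card Y₂)) → F) (M' := (Y₁ → G) × (Y₂ → G)) (by
        rw [Module.finrank_pi_fintype, Module.finrank_prod, Module.finrank_pi_fintype,
          Module.finrank_pi_fintype]
        simp [hG]
        ring)
    exact ⟨e.toAddEquiv⟩

theorem HasCSSCodes.exists_mem_achieved (F : Type*) [Field F] [Fintype F]
    (h : HasCSSCodes W E N L) (hL : 0 < L) (L₀ : ℕ) :
    ∃ L' > L₀, (fun s => (N s : ℝ) / L) ∈ achieved F W E L' := by
  classical
  obtain ⟨q₀, hq⟩ := h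
  -- The extension degree is large enough for the codes to exist and for the batch size to
  -- exceed `L₀`.
  have hz : q₀ + L₀ + 1 ≠ 0 := Nat.succ_ne_zero _
  set z := q₀ + L₀ + 1 with hzdef
  obtain ⟨G, _, _, hG, hθ⟩ := exists_field_addEquiv F hz
  have hqG : q₀ ≤ Fintype.card G := by
    have := Nat.lt_pow_self (n := z) (Fintype.one_lt_card (α := F))
    omega
  obtain ⟨I, _, srv, Y₁, Y₂, _, _, c₁, c₂, hN, hY, horth⟩ := hq G hqG
  obtain ⟨θ⟩ := hθ Y₁ Y₂
  rw [hY] at θ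
  obtain ⟨χ, hχ⟩ := (AddChar.exists_apply_ne_zero (a := (1 : G))).mpr one_ne_zero
  have hχ1 : χ ≠ 1 := by
    rintro rfl
    exact hχ rfl
  refine ⟨z * L, ?_, cssScheme c₁ c₂ θ hχ1 horth, cssScheme_correct c₁ c₂ θ hχ1 horth, ?_⟩
  · have : z * 1 ≤ z * L := Nat.mul_le_mul_left z hL
    omega
  · ext s
    change Real.logb (Fintype.card F) (Fintype.card (LocalSymbols G srv s)) / ((z * L : ℕ) : ℝ) = _
    have hd : (1 : ℝ) < Fintype.card F := by exact_mod_cast Fintype.one_lt_card (α := F)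
    have hz' : (z : ℝ) ≠ 0 := by exact_mod_cast hz
    rw [Fintype.card_fun, hN, hG, ← pow_mul, Nat.cast_pow, Real.logb_pow,
      Real.logb_self_eq_one hd, mul_one, Nat.cast_mul, Nat.cast_mul, mul_div_mul_left _ _ hz']

end HasCodes

/-! ### Asymptotic rates and the cost regions -/

section Asymptotics

variable {S K T : ℕ} {W : Fin K → Finset (Fin S)} {E : Fin T → Finset (Fin S)}

/-- The cost tuple `x` is asymptotically sufficient for pairs of orthogonal sum codes: for every `m`
there is a pair with at most `m * x s + c` symbols at the server `s` and batches of length at least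
`m - c`, where the loss `c` does not depend on `m`. -/
def IsApproximable (W : Fin K → Finset (Fin S)) (E : Fin T → Finset (Fin S))
    (x : Fin (S + 1) → ℝ) : Prop :=
  ∃ c : ℕ, ∀ m : ℕ, ∃ (N : Fin (S + 1) → ℕ) (L : ℕ),
    (∀ s, (N s : ℝ) ≤ m * x s + c) ∧ m ≤ L + c ∧ HasCSSCodes W E N L

theorem IsApproximable.mono {x y : Fin (S + 1) → ℝ} (hx : IsApproximable W E x)
    (hxy : ∀ s, x s ≤ y s) : IsApproximable W E y := by
  obtain ⟨c, hc⟩ := hx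
  refine ⟨c, fun m => ?_⟩
  obtain ⟨N, L, hN, hL, h⟩ := hc m
  exact ⟨N, L, fun s => (hN s).trans (by gcongr; exact hxy s), hL, h⟩

/-- Convex combinations are realized by direct sums, that is, by time sharing. -/
theorem convex_nonneg_isApproximable (W : Fin K → Finset (Fin S)) (E : Fin T → Finset (Fin S)) :
    Convex ℝ {x : Fin (S + 1) → ℝ | (∀ s, 0 ≤ x s) ∧ IsApproximable W E x} := by
  rintro x ⟨hx0, c, hc⟩ y ⟨hy0, c', hc'⟩ a b ha hb hab
  refine ⟨fun s => add_nonneg (mul_nonneg ha (hx0 s)) (mul_nonneg hb (hy0 s)),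
    c + c' + 2, fun m => ?_⟩
  obtain ⟨N, L, hN, hL, h⟩ := hc ⌊a * m⌋₊
  obtain ⟨N', L', hN', hL', h'⟩ := hc' ⌊b * m⌋₊
  have ham : 0 ≤ a * m := by positivity
  have hbm : 0 ≤ b * m := by positivity
  refine ⟨N + N', L + L', fun s => ?_, ?_, h.add h'⟩
  · have h1 := mul_le_mul_of_nonneg_right (Nat.floor_le ham) (hx0 s)
    have h2 := mul_le_mul_of_nonneg_right (Nat.floor_le hbm) (hy0 s)
    have h3 := hN s
    have h4 := hN' s
    simp only [Pi.add_apply, Pi.smul_apply, smul_eq_mul]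
    push_cast
    linarith
  · have h1 := Nat.lt_floor_add_one (a * m)
    have h2 := Nat.lt_floor_add_one (b * m)
    have hL : (⌊a * m⌋₊ : ℝ) ≤ L + c := by exact_mod_cast hL
    have hL' : (⌊b * m⌋₊ : ℝ) ≤ L' + c' := by exact_mod_cast hL'
    have h3 : a * m + b * m = (m : ℝ) := by rw [← add_mul, hab, one_mul]
    have h4 : (m : ℝ) ≤ ((L + L' + (c + c' + 2) : ℕ) : ℝ) := by
      push_cast
      linarith
    exact_mod_cast h4

theorem IsApproximable.of_isEmpty (h : IsEmpty (Fin K × Fin T)) {x : Fin (S + 1) → ℝ}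
    (hx : ∀ s, 0 ≤ x s) : IsApproximable W E x :=
  ⟨0, fun m => ⟨0, m, fun s => by
    have := hx s
    simp only [Pi.zero_apply, Nat.cast_zero, add_zero]
    positivity, by simp, HasCSSCodes.of_isEmpty ⟨fun r => h.elim (r.1, r.2.1)⟩ _⟩⟩

theorem sum_floor_le {ι : Type*} (A : Finset ι) (m : ℕ) {x : ι → ℝ} (hx : ∀ i, 0 ≤ x i) :
    ((∑ i ∈ A, ⌊m * x i⌋₊ : ℕ) : ℝ) ≤ m * ∑ i ∈ A, x i := by
  rw [Finset.mul_sum, Nat.cast_sum]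
  exact Finset.sum_le_sum fun i _ => Nat.floor_le (mul_nonneg m.cast_nonneg (hx i))

theorem le_sum_floor_add_card {ι : Type*} [Fintype ι] (A : Finset ι) (m : ℕ) (x : ι → ℝ) :
    m * ∑ i ∈ A, x i ≤ ((∑ i ∈ A, ⌊m * x i⌋₊ : ℕ) : ℝ) + Fintype.card ι := by
  have h : m * ∑ i ∈ A, x i ≤ ((∑ i ∈ A, ⌊m * x i⌋₊ : ℕ) : ℝ) + A.card := by
    rw [Finset.mul_sum, Nat.cast_sum, Finset.card_eq_sum_ones, Nat.cast_sum,
      ← Finset.sum_add_distrib]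
    refine Finset.sum_le_sum fun i _ => ?_
    rw [Nat.cast_one]
    exact (Nat.lt_floor_add_one _).le
  have h2 : (A.card : ℝ) ≤ Fintype.card ι := by exact_mod_cast A.card_le_univ
  linarith

theorem exists_max_sum [Nonempty (Fin T)] (N : Fin (S + 1) → ℕ) :
    ∃ t₀, ∀ t, ∑ s ∈ E t, N s.succ ≤ ∑ s ∈ E t₀, N s.succ :=
  Finite.exists_max fun t => ∑ s ∈ E t, N s.succ

theorem isApproximable_of_mem_regionTQC {x : Fin (S + 1) → ℝ} (hx : x ∈ regionTQC W E) :
    IsApproximable W E x := by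
  obtain ⟨hx0, hx⟩ := hx
  by_cases hne : IsEmpty (Fin K × Fin T)
  · exact .of_isEmpty hne hx0
  obtain ⟨-, t⟩ := not_isEmpty_iff.mp hne
  have : Nonempty (Fin T) := ⟨t⟩
  refine ⟨S, fun m => ⟨fun s => ⌊m * x s⌋₊, m - S, fun s => ?_, by omega, ?_⟩⟩
  · have := Nat.floor_le (mul_nonneg m.cast_nonneg (hx0 s))
    have hS : (0 : ℝ) ≤ S := S.cast_nonneg
    linarith
  obtain hm | hm := le_total m S
  · rw [Nat.sub_eq_zero_of_le hm]
    exact .of_isEmpty inferInstance _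
  obtain ⟨t₀, ht₀⟩ := exists_max_sum (E := E) fun s => ⌊m * x s⌋₊
  refine .of_classical ht₀ fun k => ?_
  have h1 := sum_floor_le (E t₀) m fun s => hx0 s.succ
  have h2 := le_sum_floor_add_card (W k) m fun s => x s.succ
  have h3 := mul_le_mul_of_nonneg_left (hx k t₀) (m.cast_nonneg : (0 : ℝ) ≤ m)
  rw [Fintype.card_fin] at h2
  have h4 : ((∑ s ∈ E t₀, ⌊m * x s.succ⌋₊ + m : ℕ) : ℝ) ≤
      ((∑ s ∈ W k, ⌊m * x s.succ⌋₊ + S : ℕ) : ℝ) := by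
    rw [Nat.cast_add, Nat.cast_add]
    linarith
  have h5 := Nat.cast_le.mp h4
  omega

theorem isApproximable_of_mem_regionAME {x : Fin (S + 1) → ℝ} (hx : x ∈ regionAME W E) :
    IsApproximable W E x := by
  obtain ⟨hx0, hx⟩ := hx
  by_cases hne : IsEmpty (Fin K × Fin T)
  · exact .of_isEmpty hne hx0
  obtain ⟨k₀, t⟩ := not_isEmpty_iff.mp hne
  have : Nonempty (Fin T) := ⟨t⟩
  -- Rounding down costs less than one symbol per server, that is, at most `S + 1` symbols in
  -- total and `2 * S` in twice the sum over `W k`; both are at most `2 * S + 1`.  Making the batch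
  -- size even costs one more.
  refine ⟨2 * S + 2, fun m => ⟨fun s => ⌊m * x s⌋₊, 2 * ((m - (2 * S + 1)) / 2), fun s => ?_,
    by omega, ?_⟩⟩
  · have := Nat.floor_le (mul_nonneg m.cast_nonneg (hx0 s))
    have hS : (0 : ℝ) ≤ ((2 * S + 2 : ℕ) : ℝ) := Nat.cast_nonneg _
    linarith
  obtain hm | hm := le_total m (2 * S + 1)
  · rw [Nat.sub_eq_zero_of_le hm]
    exact HasCSSCodes.of_isEmpty (L := 0) inferInstance _
  obtain ⟨t₀, ht₀⟩ := exists_max_sum (E := E) fun s => ⌊m * x s⌋₊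
  have h1 := sum_floor_le (E t₀) m fun s => hx0 s.succ
  have hmin : ∀ k, 1 + ∑ s ∈ E t₀, 2 * x s.succ ≤ ∑ s, x s ∧
      1 + ∑ s ∈ E t₀, 2 * x s.succ ≤ ∑ s ∈ W k, 2 * x s.succ :=
    fun k => le_min_iff.mp (le_sub_iff_add_le.mp (hx k t₀))
  simp only [← Finset.mul_sum] at hmin
  refine .of_quantum ht₀ (fun k => ?_) ?_
  · have h2 := le_sum_floor_add_card (W k) m fun s => x s.succ
    have h3 := mul_le_mul_of_nonneg_left (hmin k).2 (m.cast_nonneg : (0 : ℝ) ≤ m)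
    rw [Fintype.card_fin] at h2
    have h4 : ((2 * ∑ s ∈ E t₀, ⌊m * x s.succ⌋₊ + m : ℕ) : ℝ) ≤
        ((2 * ∑ s ∈ W k, ⌊m * x s.succ⌋₊ + 2 * S : ℕ) : ℝ) := by
      rw [Nat.cast_add, Nat.cast_add, Nat.cast_mul, Nat.cast_mul, Nat.cast_mul, Nat.cast_two]
      linarith
    have h5 := Nat.cast_le.mp h4
    omega
  · have h2 := le_sum_floor_add_card Finset.univ m x
    have h3 := mul_le_mul_of_nonneg_left (hmin k₀).1 (m.cast_nonneg : (0 : ℝ) ≤ m)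
    rw [Fintype.card_fin] at h2
    have h4 : ((2 * ∑ s ∈ E t₀, ⌊m * x s.succ⌋₊ + m : ℕ) : ℝ) ≤
        ((∑ s, ⌊m * x s⌋₊ + (S + 1) : ℕ) : ℝ) := by
      rw [Nat.cast_add, Nat.cast_add, Nat.cast_mul, Nat.cast_two]
      linarith
    have h5 := Nat.cast_le.mp h4
    omega

theorem IsApproximable.mem_optimalRegion (F : Type*) [Field F] [Fintype F]
    {x : Fin (S + 1) → ℝ} (hx0 : ∀ s, 0 ≤ x s) (hx : IsApproximable W E x) :
    x ∈ optimalRegion F W E := by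
  refine Set.mem_iInter.mpr fun L₀ => Metric.mem_closure_iff.mpr fun ε hε => ?_
  obtain ⟨c, hc⟩ := hx
  obtain ⟨M, hM⟩ := exists_nat_gt ((c * ∑ s, x s + c + 1) / ε)
  obtain ⟨N, L, hN, hL, h⟩ := hc (c + (M + 1))
  have hML : M < L := by omega
  have hL0 : (0 : ℝ) < L := by exact_mod_cast (by omega : 0 < L)
  -- Rounding up `L * x s` and adding unused qudits brings the cost up to `x s` where it is lower.
  set N' : Fin (S + 1) → ℕ := fun s => max (N s) ⌈L * x s⌉₊ with hN'
  obtain ⟨L', hL', hmem⟩ := (h.mono (N' := N') fun s => le_max_left _ _).exists_mem_achieved F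
    (by omega : 0 < L) L₀
  refine ⟨_, Set.mem_iUnion₂.mpr ⟨L', hL', hmem⟩, (dist_pi_lt_iff hε).mpr fun s => ?_⟩
  have hlow : L * x s ≤ N' s := (Nat.le_ceil _).trans (by exact_mod_cast le_max_right _ _)
  have hsum : x s ≤ ∑ s, x s := Finset.single_le_sum (fun s _ => hx0 s) (Finset.mem_univ s)
  have hcx : c * x s ≤ c * ∑ s, x s := mul_le_mul_of_nonneg_left hsum c.cast_nonneg
  have hupp : (N' s : ℝ) ≤ L * x s + (c * ∑ s, x s + c + 1) := by
    rw [hN', Nat.cast_max]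
    refine max_le ?_ ?_
    · have h1 := hN s
      have h2 : ((c + (M + 1) : ℕ) : ℝ) ≤ c + L := by exact_mod_cast (by omega)
      have h3 := mul_le_mul_of_nonneg_right h2 (hx0 s)
      linarith
    · have h1 := Nat.ceil_lt_add_one (mul_nonneg hL0.le (hx0 s))
      have h2 : 0 ≤ c * x s := mul_nonneg c.cast_nonneg (hx0 s)
      have h3 : (0 : ℝ) ≤ c := c.cast_nonneg
      linarith
  have hLM : (M : ℝ) < L := by exact_mod_cast hML
  have hC : c * ∑ s, x s + c + 1 < L * ε := (div_lt_iff₀ hε).mp (hM.trans hLM)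
  rw [Real.dist_eq, abs_lt, neg_lt_sub_iff_lt_add, sub_lt_iff_lt_add]
  constructor
  · rw [div_lt_iff₀ hL0]
    linarith
  · have h1 : x s ≤ N' s / L := by rw [le_div_iff₀ hL0]; linarith
    linarith

end Asymptotics

end QEMAC

end

theorem theorem1 (F : Type*) [Field F] [Fintype F] (S K T : ℕ)
    (W : Fin K → Finset (Fin S)) (E : Fin T → Finset (Fin S)) :
    QEMAC.achievableRegion W E ⊆ QEMAC.optimalRegion F W E := by
  have hhull := convexHull_min (s := QEMAC.upward (QEMAC.regionAME W E) ∪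
    QEMAC.upward (QEMAC.regionTQC W E)) ?_ (QEMAC.convex_nonneg_isApproximable W E)
  · exact fun x hx => (hhull hx).2.mem_optimalRegion F (hhull hx).1
  · rintro x (⟨hx0, y, hy, hyx⟩ | ⟨hx0, y, hy, hyx⟩)
    · exact ⟨hx0, (QEMAC.isApproximable_of_mem_regionAME hy).mono hyx⟩
    · exact ⟨hx0, (QEMAC.isApproximable_of_mem_regionTQC hy).mono hyx⟩
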